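/- Let $r\in\mathbb N$, $r\ge 1$, and let $k$ be an integer with $0\le k\le r-1$. Let $\mathbb I=[-1,1]$, and let $\|\cdot\|_2$ and $\|\cdot\|_\infty$ be the norms of $L_2(\mathbb I)$ and $L_\infty(\mathbb I)$ (real-valued functions). Let $L_2^r$ be the space of functions $f:\mathbb I\to\mathbb R$ whose derivative $f^{(r-1)}$ exists and is absolutely continuous on $\mathbb I$ and for which $f^{(r)}\in L_2(\mathbb I)$, and let $W_2^r=\{f\in L_2^r:\|f^{(r)}\|_2\le 1\}$. For $\delta\ge 0$ and $t\in\mathbb I$ put \[ \Omega(\delta)=\sup\{\|f^{(k)}\|_\infty: f\in W_2^r,\ \|f\|_2\le\delta\},\qquad \Omega_t(\delta)=\sup\{|f^{(k)}(t)|: f\in W_2^r,\ \|f\|_2\le\delta\}. \] Let $\Gamma$ be the set of all pairs $(A,B)$ of non-negative real numbers such that $\|f^{(k)}\|_\infty\le A\|f\|_2+B\|f^{(r)}\|_2$ for every $f\in L_2^r$ and \[ B=\sup_{f\in W_2^r}\bigl(\|f^{(k)}\|_\infty-A\|f\|_2\bigr), \] and, for $t\in\mathbb I$, let $\Gamma_t$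 be the set of all pairs $(A,B)$ of non-negative real numbers such that $|f^{(k)}(t)|\le A\|f\|_2+B\|f^{(r)}\|_2$ for every $f\in L_2^r$ and $B=\sup_{f\in W_2^r}\bigl(|f^{(k)}(t)|-A\|f\|_2\bigr)$. Suppose that every eigenfunction, i.e. every function $\varphi:\mathbb I\to\mathbb R$, not identically zero, which for some $\lambda>0$ satisfies \[ (-1)^r\varphi^{(2r)}(x)=\lambda\varphi(x),\quad x\in(-1,1),\qquad \varphi^{(s)}(-1)=\varphi^{(s)}(1)=0,\quad s=0,1,\dots,r-1, \] (in the classical sense, with $\varphi\in C^{2r}(\mathbb I)$) has the property $\|\varphi^{(r+k)}\|_\infty=|\varphi^{(r+k)}(-1)|$. Then \[ \Omega(\delta)=\sup_{t\in\mathbb I}\Omega_t(\delta)=\Omega_{-1}(\delta)\quad\text{for all }\delta\ge 0, \qquad\text{and}\qquad \Gamma=\Gamma_{-1}. \] -/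

import Mathlib

open MeasureTheory Set
open scoped NNReal ENNReal

namespace LandauKolmogorov

/-- The interval `[-1, 1]`. -/
abbrev II : Set ℝ := Icc (-1) 1

/-- The `n`-th derivative of `f` on the closed interval `[-1, 1]`, one-sided at the endpoints.
It depends only on the values of `f` on `[-1, 1]`. -/
noncomputable abbrev D (n : ℕ) (f : ℝ → ℝ) : ℝ → ℝ := iteratedDerivWithin n f II

/-- The norm of `L_p([-1, 1])`, with value `∞` off `L_p`. -/
noncomputable def nrm (p : ℝ≥0∞) (f : ℝ → ℝ) : ℝ≥0∞ := eLpNorm f p (volume.restrict II)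

/-- The space `L_2^r`, `r ≥ 1`: the derivative `f^(r-1)` exists and is absolutely continuous on
`[-1, 1]`, and `f^(r)`, which then exists almost everywhere, lies in `L_2`.
(An absolutely continuous derivative is continuous, hence `f` is `C^(r-1)`.) -/
structure MemL2 (r : ℕ) (f : ℝ → ℝ) : Prop where
  contDiffOn : ContDiffOn ℝ ((r - 1 : ℕ) : ℕ∞) f II
  absCont : AbsolutelyContinuousOnInterval (D (r - 1) f) (-1) 1
  memLp : MemLp (D r f) 2 (volume.restrict II)

/-- The class `W_2^r` of all `f ∈ L_2^r` with `‖f^(r)‖_2 ≤ 1`. -/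
def W2 (r : ℕ) : Set (ℝ → ℝ) := {f | MemL2 r f ∧ nrm 2 (D r f) ≤ 1}

/-- The modulus of continuity `Ω(δ) = sup {‖f^(k)‖_∞ : f ∈ W_2^r, ‖f‖_2 ≤ δ}`. -/
noncomputable def Omega (r k : ℕ) (δ : ℝ≥0) : ℝ≥0∞ :=
  ⨆ f ∈ {f | f ∈ W2 r ∧ nrm 2 f ≤ δ}, nrm ∞ (D k f)

/-- The pointwise modulus `Ω_t(δ) = sup {|f^(k)(t)| : f ∈ W_2^r, ‖f‖_2 ≤ δ}`. -/
noncomputable def OmegaAt (r k : ℕ) (t : ℝ) (δ : ℝ≥0) : ℝ≥0∞ :=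
  ⨆ f ∈ {f | f ∈ W2 r ∧ nrm 2 f ≤ δ}, ENNReal.ofReal |D k f t|

/-- The set `Γ` of pairs `(A, B)` of nonnegative numbers for which
`‖f^(k)‖_∞ ≤ A ‖f‖_2 + B ‖f^(r)‖_2` on `L_2^r`, sharp in the sense that
`B = sup_{f ∈ W_2^r} (‖f^(k)‖_∞ - A ‖f‖_2)`.
For `k < r` all the norms of functions of `L_2^r` that occur are finite. -/
def Gam (r k : ℕ) : Set (ℝ × ℝ) :=
  {p | 0 ≤ p.1 ∧ 0 ≤ p.2 ∧
    (∀ f, MemL2 r f →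
      (nrm ∞ (D k f)).toReal ≤ p.1 * (nrm 2 f).toReal + p.2 * (nrm 2 (D r f)).toReal) ∧
    IsLUB ((fun f => (nrm ∞ (D k f)).toReal - p.1 * (nrm 2 f).toReal) '' W2 r) p.2}

/-- The set `Γ_t` of pairs `(A, B)` of nonnegative numbers for which
`|f^(k)(t)| ≤ A ‖f‖_2 + B ‖f^(r)‖_2` on `L_2^r`, sharp in the sense that
`B = sup_{f ∈ W_2^r} (|f^(k)(t)| - A ‖f‖_2)`. -/
def GamAt (r k : ℕ) (t : ℝ) : Set (ℝ × ℝ) :=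
  {p | 0 ≤ p.1 ∧ 0 ≤ p.2 ∧
    (∀ f, MemL2 r f →
      |D k f t| ≤ p.1 * (nrm 2 f).toReal + p.2 * (nrm 2 (D r f)).toReal) ∧
    IsLUB ((fun f => |D k f t| - p.1 * (nrm 2 f).toReal) '' W2 r) p.2}

/-- `φ` is an eigenfunction, with eigenvalue `lam > 0`, of
`(-1)^r φ^(2r) = lam φ` on `(-1, 1)`, `φ^(s)(-1) = φ^(s)(1) = 0` for `0 ≤ s ≤ r - 1`. -/
structure IsEigenfunction (r : ℕ) (lam : ℝ) (φ : ℝ → ℝ) : Prop where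
  pos : 0 < lam
  contDiffOn : ContDiffOn ℝ ((2 * r : ℕ) : ℕ∞) φ II
  ne_zero : ∃ x ∈ II, φ x ≠ 0
  eqn : ∀ x ∈ Ioo (-1 : ℝ) 1, (-1) ^ r * D (2 * r) φ x = lam * φ x
  left_bc : ∀ s < r, D s φ (-1) = 0
  right_bc : ∀ s < r, D s φ 1 = 0

end LandauKolmogorov

/-! Write `f` in `L_2^r` as a polynomial of degree below `r`, expanded in Legendre polynomials, plus
`S h`. Here `h = f^(r)` and `S = (1 - Π) J^r`, with `J` the primitive from `-1` and `Π` the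
orthogonal projection onto those polynomials. The two parts are orthogonal, so `‖f‖_2^2` is `∑ c_j^2
‖P_j‖^2 + ⟨S†S h, h⟩` (`nrm_synth`). The operator `S†S` is compact and symmetric, hence `h` is an
orthogonal sum of its eigenvectors. Changing the signs of the `c_j` and of the eigencomponents of
`h` alters neither `‖f‖_2` nor `‖f^(r)‖_2`.

Each building block has its largest `k`-th derivative at `-1`. For Legendre polynomials this is a
Sonin-type monotonicity argument (`abs_eval_le_of_gegenbauer`). An eigenvector `x` with positive
eigenvalue is an eigenfunction `φ` of the boundary value problem, and `S x` is a multiple of `φ^(r)`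
(`exists_isEigenfunction`), so the hypothesis on `φ^(r+k)` applies. Choosing the signs so that all
contributions to the `k`-th derivative at `-1` are nonnegative yields a `g` with the same norms as
`f` and `|f^(k)(t)| ≤ |g^(k)(-1)|` for all `t` (`exists_dominating`). Both claims follow by
replacing `f` by `g`. -/

/-! ### Spectral decomposition of compact symmetric operators and sign changes -/

section Hilbert

variable {H : Type*} [NormedAddCommGroup H] [InnerProductSpace ℝ H]

/-- Parseval identities for a convergent sum of eigenvectors of a symmetric operator. -/
theorem hasSum_norm_sq_of_eigenvectors {T : H →L[ℝ] H} (hs : T.IsSymmetric) {y : ℝ → H} {h : H}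
    (hy : ∀ μ, T (y μ) = μ • y μ) (hh : HasSum y h) :
    HasSum (fun μ => ‖y μ‖ ^ 2) (‖h‖ ^ 2) ∧
      HasSum (fun μ => μ * ‖y μ‖ ^ 2) (inner ℝ (T h) h) := by
  have horth : ∀ μ ν, μ ≠ ν → inner ℝ (y μ) (y ν) = 0 := by
    intro μ ν hne
    have h1 : inner ℝ (T (y μ)) (y ν) = inner ℝ (y μ) (T (y ν)) := hs (y μ) (y ν)
    rw [hy, hy, real_inner_smul_left, real_inner_smul_right] at h1
    have h2 : (μ - ν) * inner ℝ (y μ) (y ν) = 0 := by linarith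
    exact (mul_eq_zero.1 h2).resolve_left (sub_ne_zero.2 hne)
  have hin : ∀ μ, inner ℝ (y μ) h = ‖y μ‖ ^ 2 := by
    intro μ
    have h1 : HasSum (fun ν => inner ℝ (y μ) (y ν)) (inner ℝ (y μ) h) :=
      hh.mapL (innerSL ℝ (y μ))
    have h2 : HasSum (fun ν => inner ℝ (y μ) (y ν)) (inner ℝ (y μ) (y μ)) :=
      hasSum_single μ fun ν hν => horth μ ν hν.symm
    rw [h1.unique h2, real_inner_self_eq_norm_sq]
  constructor
  · have h1 : HasSum (fun ν => inner ℝ h (y ν)) (inner ℝ h h) := hh.mapL (innerSL ℝ h)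
    rw [real_inner_self_eq_norm_sq] at h1
    simpa only [fun μ => (real_inner_comm h (y μ)).symm.trans (hin μ)] using h1
  · have h1 : HasSum (fun ν => inner ℝ (T h) (y ν)) (inner ℝ (T h) h) :=
      hh.mapL (innerSL ℝ (T h))
    convert h1 using 1
    ext μ
    have h2 : inner ℝ (T h) (y μ) = inner ℝ h (T (y μ)) := hs h (y μ)
    rw [h2, hy, real_inner_smul_right, real_inner_comm, hin]

/-- Spectral decomposition of a vector with respect to a compact symmetric operator; changing
signs of the components changes neither the norm nor the quadratic form. -/
theorem exists_hasSum_eigenvectors [CompleteSpace H] {T : H →L[ℝ] H} (hc : IsCompactOperator T)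
    (hs : T.IsSymmetric) (h : H) :
    ∃ x : ℝ → H, (∀ μ, T (x μ) = μ • x μ) ∧ HasSum x h ∧
      ∀ ε : ℝ → ℝ, (∀ μ, ε μ ^ 2 = 1) → ∃ h' : H, HasSum (fun μ => ε μ • x μ) h' ∧
        ‖h'‖ = ‖h‖ ∧ inner ℝ (T h') h' = inner ℝ (T h) h := by
  have hortho := LinearMap.IsSymmetric.orthogonalFamily_eigenspaces (𝕜 := ℝ) (T := (T : H →ₗ[ℝ] H)) hs
  have hcl : ∀ μ : ℝ, IsClosed
      ((Module.End.eigenspace (T : Module.End ℝ H) μ : Submodule ℝ H) : Set H) := by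
    intro μ
    have : ((Module.End.eigenspace (T : Module.End ℝ H) μ : Submodule ℝ H) : Set H)
        = {v | T v = μ • v} := by
      ext v
      simp
    rw [this]
    exact isClosed_eq T.continuous (continuous_const_smul μ)
  have : ∀ μ : ℝ, CompleteSpace (Module.End.eigenspace (T : Module.End ℝ H) μ) :=
    fun μ => (hcl μ).completeSpace_coe
  -- The index set is all of `ℝ`; the eigenspace is trivial unless `μ` is an eigenvalue.
  have hV : IsHilbertSum ℝ (fun μ : ℝ => Module.End.eigenspace (T : Module.End ℝ H) μ)
      (fun μ => (Module.End.eigenspace (T : Module.End ℝ H) μ).subtypeₗᵢ) := by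
    refine IsHilbertSum.mkInternal _ hortho ?_
    rw [Submodule.topologicalClosure_eq_top_iff.2
      (ContinuousLinearMap.orthogonalComplement_iSup_eigenspaces_eq_bot hc hs)]
  set w := hV.linearIsometryEquiv h with hw
  have hx : HasSum (fun μ => ((w μ : Module.End.eigenspace (T : Module.End ℝ H) μ) : H)) h := by
    have := hV.hasSum_linearIsometryEquiv_symm w
    rwa [hw, LinearIsometryEquiv.symm_apply_apply] at this
  have hT : ∀ μ, T ((w μ : Module.End.eigenspace (T : Module.End ℝ H) μ) : H)
      = μ • ((w μ : Module.End.eigenspace (T : Module.End ℝ H) μ) : H) := fun μ =>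
    Module.End.mem_eigenspace_iff.1 (w μ).2
  refine ⟨fun μ => w μ, hT, hx, fun ε hε => ?_⟩
  -- For orthogonal families summability depends only on the squared norms, which signs do not
  -- affect.
  have hsum : Summable fun μ => ε μ • ((w μ : Module.End.eigenspace (T : Module.End ℝ H) μ) : H) := by
    have h1 := (hortho.summable_iff_norm_sq_summable (fun μ => w μ)).1 hx.summable
    refine (hortho.summable_iff_norm_sq_summable (fun μ => ε μ • w μ)).2 ?_
    simpa [norm_smul, mul_pow, hε] using h1
  obtain ⟨h', hh'⟩ := hsum
  have hT' : ∀ μ, T (ε μ • ((w μ : Module.End.eigenspace (T : Module.End ℝ H) μ) : H))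
      = μ • (ε μ • ((w μ : Module.End.eigenspace (T : Module.End ℝ H) μ) : H)) := by
    intro μ
    rw [map_smul, hT, smul_comm]
  obtain ⟨a1, a2⟩ := hasSum_norm_sq_of_eigenvectors hs hT hx
  obtain ⟨b1, b2⟩ := hasSum_norm_sq_of_eigenvectors hs hT' hh'
  simp only [norm_smul, mul_pow, Real.norm_eq_abs, sq_abs, hε, one_mul] at b1 b2
  refine ⟨h', hh', ?_, b2.unique a2⟩
  have := b1.unique a1
  exact (pow_left_inj₀ (norm_nonneg _) (norm_nonneg _) two_ne_zero).1 this

end Hilbert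

/-! ### Legendre polynomials: differential equation, orthogonality, extremality at `-1` -/

section Legendre

open Polynomial

/-- Legendre polynomials, unnormalised, by Rodrigues' formula. -/
noncomputable def legendrePoly (n : ℕ) : ℝ[X] := derivative^[n] ((X ^ 2 - 1) ^ n)

/-- With `w = (X^2 - 1)^n` one has `(X^2 - 1) w' = 2 n X w`; differentiating this `m + 1` times
gives the identity. The base case differentiates once, each induction step once more. -/
theorem iterate_derivative_sq_sub_one_pow (n m : ℕ) :
    (X ^ 2 - 1) * derivative^[m + 2] ((X ^ 2 - 1 : ℝ[X]) ^ n)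
      + C (2 * (m + 1) : ℝ) * X * derivative^[m + 1] ((X ^ 2 - 1 : ℝ[X]) ^ n)
      + C ((m + 1) * m : ℝ) * derivative^[m] ((X ^ 2 - 1 : ℝ[X]) ^ n)
    = C (2 * n : ℝ) * (X * derivative^[m + 1] ((X ^ 2 - 1 : ℝ[X]) ^ n)
      + C (m + 1 : ℝ) * derivative^[m] ((X ^ 2 - 1 : ℝ[X]) ^ n)) := by
  induction m with
  | zero =>
    have h1 : (X ^ 2 - 1) * derivative ((X ^ 2 - 1 : ℝ[X]) ^ n)
        = C (2 * n : ℝ) * (X * (X ^ 2 - 1 : ℝ[X]) ^ n) := by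
      cases n with
      | zero => simp
      | succ n =>
        simp [derivative_pow]
        ring
    have h2 := congrArg derivative h1
    simp only [derivative_mul, derivative_sub, derivative_X_pow, derivative_one, derivative_C,
      derivative_X, zero_mul, zero_add, one_mul, sub_zero] at h2
    simp only [Function.iterate_succ, Function.iterate_zero, Function.comp_apply, id,
      Nat.cast_zero, zero_add, mul_zero, C_0, zero_mul, add_zero, mul_one, C_1, one_mul]
    simp at h2 ⊢
    linear_combination h2
  | succ m ih =>
    have h2 := congrArg derivative ih
    simp only [derivative_mul, derivative_sub, derivative_add, derivative_X_pow, derivative_one,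
      derivative_C, derivative_X, zero_mul, zero_add, one_mul, sub_zero,
      ← Function.iterate_succ_apply' (⇑(derivative : ℝ[X] →ₗ[ℝ] ℝ[X]))] at h2
    simp [map_ofNat (C : ℝ →+* ℝ[X])] at h2 ⊢
    linear_combination h2

theorem legendrePoly_gegenbauer (n k : ℕ) :
    (X ^ 2 - 1) * derivative^[k + 2] (legendrePoly n)
      + C (2 * (k + 1) : ℝ) * X * derivative^[k + 1] (legendrePoly n)
    = C (((n : ℝ) - k) * (n + k + 1)) * derivative^[k] (legendrePoly n) := by
  have h := iterate_derivative_sq_sub_one_pow n (k + n)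
  simp only [legendrePoly, ← Function.iterate_add_apply]
  rw [show k + 2 + n = k + n + 2 by ring, show k + 1 + n = k + n + 1 by ring]
  simp [map_ofNat (C : ℝ →+* ℝ[X])] at h ⊢
  linear_combination h

theorem legendrePoly_degree (n : ℕ) : (legendrePoly n).degree = n := by
  have hm : ((X ^ 2 - 1 : ℝ[X]) ^ n).Monic :=
    Monic.pow (by simpa using monic_X_pow_sub_C (1 : ℝ) two_ne_zero) n
  have hd : ((X ^ 2 - 1 : ℝ[X]) ^ n).natDegree = 2 * n := by
    rw [natDegree_pow, show (X ^ 2 - 1 : ℝ[X]) = X ^ 2 - C 1 by simp, natDegree_X_pow_sub_C,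
      mul_comm]
  have hc : (legendrePoly n).coeff n ≠ 0 := by
    rw [legendrePoly, coeff_iterate_derivative, show n + n = 2 * n by ring, ← hd,
      hm.coeff_natDegree]
    simp [Nat.descFactorial_eq_zero_iff_lt, hd]
    omega
  refine le_antisymm ?_ (le_degree_of_ne_zero hc)
  refine natDegree_le_iff_degree_le.1 ?_
  have := natDegree_iterate_derivative ((X ^ 2 - 1 : ℝ[X]) ^ n) n
  rw [hd] at this
  exact this.trans (by omega)

theorem exists_sum_legendrePoly {r : ℕ} {q : ℝ[X]} (hq : q.degree < r) :
    ∃ c : ℕ → ℝ, q = ∑ j ∈ Finset.range r, c j • legendrePoly j := by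
  let S : Polynomial.Sequence ℝ := ⟨legendrePoly, legendrePoly_degree⟩
  have h := S.span_degreeLT (m := r) fun i _ => by
    rw [isUnit_iff_ne_zero, Ne, leadingCoeff_eq_zero]
    exact S.ne_zero i
  have hq' : q ∈ Submodule.span ℝ (S '' Set.Iio r) := by
    rw [h]; exact mem_degreeLT.2 hq
  have himg : S '' Set.Iio r = ((Finset.range r : Finset ℕ) : Set ℕ).image S := by
    congr 1; ext; simp
  rw [himg, Submodule.mem_span_image_finset_iff_exists_fun] at hq'
  obtain ⟨c, hc⟩ := hq'
  refine ⟨fun j => if h : j ∈ Finset.range r then c ⟨j, h⟩ else 0, ?_⟩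
  rw [← hc, ← Finset.sum_coe_sort (Finset.range r)]
  exact Finset.sum_congr rfl fun j _ => by simp [S, j.2]

/-- `(X^2 - 1)^n` is even, so each of its derivatives is even or odd; squaring removes the sign. -/
theorem legendrePoly_parity (n k : ℕ) :
    ((derivative^[k] (legendrePoly n)).eval 1) ^ 2
      = ((derivative^[k] (legendrePoly n)).eval (-1)) ^ 2 := by
  have key : ∀ m, (derivative^[m] ((X ^ 2 - 1 : ℝ[X]) ^ n)).comp (-X)
      = (-1) ^ m * derivative^[m] ((X ^ 2 - 1 : ℝ[X]) ^ n) := by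
    intro m
    induction m with
    | zero => simp
    | succ m ih =>
      have h := congrArg derivative ih
      rw [derivative_comp] at h
      rw [Function.iterate_succ_apply']
      have h0 : derivative ((-1 : ℝ[X]) ^ m) = 0 := by
        rw [show (-1 : ℝ[X]) = C (-1) by simp, ← C_pow, derivative_C]
      rw [derivative_mul, h0] at h
      simp at h
      linear_combination (-1 : ℝ[X]) * h
  have h := congrArg (eval 1) (key (k + n))
  simp only [eval_comp, eval_neg, eval_X, eval_mul, eval_pow, eval_one] at h
  simp only [legendrePoly, ← Function.iterate_add_apply]
  rw [h, mul_pow, ← pow_mul, mul_comm (k + n), pow_mul]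
  simp

/-- Sonin's function `F = N y^2 + (1 - x^2) y'^2` dominates `N y^2` on the interval and equals it at
`±1`. The equation gives `F' = (4 a - 2) x y'^2`, so `F` decreases on `[-1, 0]` and increases on
`[0, 1]`; its maximum is attained at an endpoint, and the two endpoint values agree. -/
theorem abs_eval_le_of_gegenbauer {y : ℝ[X]} {a N : ℝ} (ha : 1 ≤ a) (hN : 0 < N)
    (hode : (X ^ 2 - 1) * derivative (derivative y) + C (2 * a) * X * derivative y = C N * y)
    (hpar : (y.eval 1) ^ 2 = (y.eval (-1)) ^ 2) {t : ℝ} (ht : t ∈ Icc (-1 : ℝ) 1) :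
    |y.eval t| ≤ |y.eval (-1)| := by
  set F : ℝ[X] := C N * y ^ 2 + (1 - X ^ 2) * derivative y ^ 2 with hF
  have hF' : derivative F = C (4 * a - 2) * X * derivative y ^ 2 := by
    simp [hF, derivative_pow, map_ofNat (C : ℝ →+* ℝ[X])]
    simp [map_ofNat (C : ℝ →+* ℝ[X])] at hode
    linear_combination (-2 * derivative y) * hode
  have hle : N * y.eval t ^ 2 ≤ F.eval t := by
    have : 0 ≤ (1 - t ^ 2) * (derivative y).eval t ^ 2 :=
      mul_nonneg (by nlinarith [ht.1, ht.2]) (sq_nonneg _)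
    simp [hF]; linarith
  have hend : F.eval t ≤ N * y.eval (-1) ^ 2 := by
    rcases le_total t 0 with h0 | h0
    · have hanti : AntitoneOn (fun x => F.eval x) (Icc (-1) 0) := by
        refine antitoneOn_of_deriv_nonpos (convex_Icc _ _) F.continuous.continuousOn
          F.differentiable.differentiableOn fun x hx => ?_
        rw [interior_Icc] at hx
        rw [Polynomial.deriv, hF']
        simp
        exact mul_nonpos_of_nonpos_of_nonneg
          (mul_nonpos_of_nonneg_of_nonpos (by linarith) hx.2.le) (sq_nonneg _)
      have := hanti (left_mem_Icc.2 (by norm_num)) ⟨ht.1, h0⟩ ht.1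
      simpa [hF] using this
    · have hmono : MonotoneOn (fun x => F.eval x) (Icc 0 1) := by
        refine monotoneOn_of_deriv_nonneg (convex_Icc _ _) F.continuous.continuousOn
          F.differentiable.differentiableOn fun x hx => ?_
        rw [interior_Icc] at hx
        rw [Polynomial.deriv, hF']
        simp
        exact mul_nonneg (mul_nonneg (by linarith) hx.1.le) (sq_nonneg _)
      have := hmono ⟨h0, ht.2⟩ (right_mem_Icc.2 (by norm_num)) ht.2
      simpa [hF, hpar] using this
  exact sq_le_sq.1 (le_of_mul_le_mul_left (hle.trans hend) hN)

theorem abs_eval_iterate_derivative_legendrePoly_le (n k : ℕ) {t : ℝ} (ht : t ∈ Icc (-1 : ℝ) 1) :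
    |(derivative^[k] (legendrePoly n)).eval t| ≤ |(derivative^[k] (legendrePoly n)).eval (-1)| := by
  rcases lt_or_ge k n with h | h
  · have h1 := legendrePoly_gegenbauer n k
    rw [Function.iterate_succ_apply', Function.iterate_succ_apply'] at h1
    refine abs_eval_le_of_gegenbauer (a := k + 1) (N := ((n : ℝ) - k) * (n + k + 1)) ?_ ?_ h1
      (legendrePoly_parity n k) ht
    · have : (0 : ℝ) ≤ k := Nat.cast_nonneg k
      linarith
    · have : (k : ℝ) < n := by exact_mod_cast h
      exact mul_pos (by linarith) (by positivity)
  -- For `k ≥ n` the factor `n - k` is no longer positive, but the derivative is constant.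
  · have h1 : (derivative^[k] (legendrePoly n)).natDegree = 0 := by
      have := natDegree_iterate_derivative (legendrePoly n) k
      rw [natDegree_eq_of_degree_eq_some (legendrePoly_degree n)] at this
      omega
    rw [eq_C_of_natDegree_eq_zero h1]
    simp

theorem integral_legendrePoly_mul {m n : ℕ} (hmn : m ≠ n) :
    ∫ x in (-1 : ℝ)..1, (legendrePoly m).eval x * (legendrePoly n).eval x = 0 := by
  -- Self-adjoint form `((x^2 - 1) P_n')' = n (n + 1) P_n`, tested against `p`; the factor `x^2 - 1`
  -- removes the boundary terms. Swapping `m` and `n` and subtracting leaves the difference of the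
  -- eigenvalues times the integral.
  have key : ∀ (p : ℝ[X]) (n : ℕ), ∫ x in (-1 : ℝ)..1,
      (p.eval x * (((n : ℝ) * (n + 1)) * (legendrePoly n).eval x)
        + (derivative p).eval x * ((x ^ 2 - 1) * (derivative (legendrePoly n)).eval x)) = 0 := by
    intro p n
    have hd : ∀ x : ℝ, HasDerivAt (fun x => (p * ((X ^ 2 - 1) * derivative (legendrePoly n))).eval x)
        (p.eval x * (((n : ℝ) * (n + 1)) * (legendrePoly n).eval x)
        + (derivative p).eval x * ((x ^ 2 - 1) * (derivative (legendrePoly n)).eval x)) x := by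
      intro x
      refine ((p * ((X ^ 2 - 1) * derivative (legendrePoly n))).hasDerivAt x).congr_deriv ?_
      have h1 := congrArg (eval x) (legendrePoly_gegenbauer n 0)
      simp at h1 ⊢
      linear_combination p.eval x * h1
    rw [intervalIntegral.integral_eq_sub_of_hasDerivAt (fun x _ => hd x)]
    · simp
    · exact Continuous.intervalIntegrable (by fun_prop) _ _
  have h1 := key (legendrePoly m) n
  have h2 := key (legendrePoly n) m
  have h3 : (((n : ℝ) * (n + 1)) - (m : ℝ) * (m + 1)) *
      ∫ x in (-1 : ℝ)..1, (legendrePoly m).eval x * (legendrePoly n).eval x = 0 := by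
    rw [← intervalIntegral.integral_const_mul, ← sub_eq_zero.2 (h1.trans h2.symm),
      ← intervalIntegral.integral_sub]
    · refine intervalIntegral.integral_congr fun x _ => ?_
      ring
    · exact Continuous.intervalIntegrable (by fun_prop) _ _
    · exact Continuous.intervalIntegrable (by fun_prop) _ _
  refine (mul_eq_zero.1 h3).resolve_left ?_
  have : ((n : ℝ) * (n + 1)) - (m : ℝ) * (m + 1) = (n - m) * (n + m + 1) := by ring
  rw [this]
  refine mul_ne_zero (sub_ne_zero.2 ?_) (by positivity)
  exact_mod_cast hmn.symm

end Legendre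

/-! ### The primitive as a compact operator on `L_2` -/

namespace LandauKolmogorov

open BoundedContinuousFunction

/-- Lebesgue measure on `[-1, 1]`. -/
noncomputable abbrev volII : Measure ℝ := volume.restrict II

/-- The Hilbert space `L_2([-1, 1])`. -/
abbrev L2II : Type := Lp ℝ 2 volII

/-- The primitive vanishing at `-1`. -/
noncomputable def J (u : ℝ → ℝ) (x : ℝ) : ℝ := ∫ s in (-1 : ℝ)..x, u s

theorem ii_subset {x y : ℝ} (hx : x ∈ II) (hy : y ∈ II) : uIcc x y ⊆ II :=
  ordConnected_Icc.uIcc_subset hx hy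

theorem neg_one_mem_ii : (-1 : ℝ) ∈ II := left_mem_Icc.2 (by norm_num)

theorem one_mem_ii : (1 : ℝ) ∈ II := right_mem_Icc.2 (by norm_num)

theorem intervalIntegrable_of_mem_ii {u : ℝ → ℝ} (hu : IntegrableOn u II) {x y : ℝ} (hx : x ∈ II)
    (hy : y ∈ II) : IntervalIntegrable u volume x y :=
  (hu.mono_set (ii_subset hx hy)).intervalIntegrable

theorem integrableOn_of_memLp_two {u : ℝ → ℝ} (hu : MemLp u 2 volII) : IntegrableOn u II :=
  hu.integrable (by norm_num)

theorem L2II.integrableOn (h : L2II) : IntegrableOn h II := integrableOn_of_memLp_two (Lp.memLp h)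

theorem J_sub {u : ℝ → ℝ} (hu : IntegrableOn u II) {x y : ℝ} (hx : x ∈ II) (hy : y ∈ II) :
    J u y - J u x = ∫ s in x..y, u s :=
  intervalIntegral.integral_interval_sub_left (intervalIntegrable_of_mem_ii hu neg_one_mem_ii hy)
    (intervalIntegrable_of_mem_ii hu neg_one_mem_ii hx)

theorem J_congr_ae {u v : ℝ → ℝ} (h : u =ᵐ[volII] v) : EqOn (J u) (J v) II := by
  intro x hx
  refine intervalIntegral.integral_congr_ae ?_
  rw [Filter.EventuallyEq, ae_restrict_iff' measurableSet_Icc] at h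
  filter_upwards [h] with s hs hsx
  exact hs (ii_subset neg_one_mem_ii hx (uIoc_subset_uIcc hsx))

theorem J_congr {u v : ℝ → ℝ} (h : EqOn u v II) : EqOn (J u) (J v) II :=
  J_congr_ae ((ae_restrict_iff' measurableSet_Icc).2 (Filter.Eventually.of_forall h))

theorem ae_eq_of_eqOn {u v : ℝ → ℝ} (h : EqOn u v II) : u =ᵐ[volII] v :=
  (ae_restrict_iff' measurableSet_Icc).2 (Filter.Eventually.of_forall h)

theorem J_iterate_congr {u v : ℝ → ℝ} (h : EqOn u v II) (m : ℕ) : EqOn (J^[m] u) (J^[m] v) II := by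
  induction m with
  | zero => exact h
  | succ m ih => rw [Function.iterate_succ_apply', Function.iterate_succ_apply']; exact J_congr ih

theorem absolutelyContinuous_J {u : ℝ → ℝ} (hu : IntegrableOn u II) :
    AbsolutelyContinuousOnInterval (J u) (-1) 1 :=
  (intervalIntegrable_of_mem_ii hu neg_one_mem_ii one_mem_ii)
    |>.absolutelyContinuousOnInterval_intervalIntegral left_mem_uIcc

theorem uIcc_neg_one_one : uIcc (-1 : ℝ) 1 = II := uIcc_of_le (by norm_num)

theorem continuousOn_J {u : ℝ → ℝ} (hu : IntegrableOn u II) : ContinuousOn (J u) II :=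
  uIcc_neg_one_one ▸ (absolutelyContinuous_J hu).continuousOn

theorem J_neg_one (u : ℝ → ℝ) : J u (-1) = 0 := intervalIntegral.integral_same

theorem integral_volII (u : ℝ → ℝ) : ∫ x, u x ∂volII = ∫ x in (-1 : ℝ)..1, u x := by
  rw [intervalIntegral.integral_of_le (by norm_num), integral_Icc_eq_integral_Ioc]

/-- Integration by parts for primitives. -/
theorem integral_J_mul {u v : ℝ → ℝ} (hu : IntegrableOn u II) (hv : IntegrableOn v II) :
    ∫ x in (-1 : ℝ)..1, (u x * J v x + J u x * v x) = J u 1 * J v 1 := by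
  have h := (absolutelyContinuous_J hu).integral_deriv_mul_eq_sub (absolutelyContinuous_J hv)
  rw [J_neg_one, zero_mul, sub_zero] at h
  rw [← h]
  refine intervalIntegral.integral_congr_ae ?_
  have hm : (-1 : ℝ) ∈ uIcc (-1 : ℝ) 1 := left_mem_uIcc
  filter_upwards [(intervalIntegrable_of_mem_ii hu neg_one_mem_ii one_mem_ii).ae_hasDerivAt_integral,
    (intervalIntegrable_of_mem_ii hv neg_one_mem_ii one_mem_ii).ae_hasDerivAt_integral]
    with x h1 h2 hx
  have e1 : deriv (J u) x = u x := (h1 (uIoc_subset_uIcc hx) _ hm).deriv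
  have e2 : deriv (J v) x = v x := (h2 (uIoc_subset_uIcc hx) _ hm).deriv
  rw [e1, e2]

/-- Cauchy–Schwarz against the indicator of `(x, y]`. This Hölder bound supplies the equicontinuity
behind compactness. -/
theorem abs_integral_le_norm_mul_sqrt (h : L2II) {x y : ℝ} (hx : x ∈ II) (hy : y ∈ II) :
    |∫ s in x..y, h s| ≤ ‖h‖ * √|y - x| := by
  wlog hxy : x ≤ y generalizing x y
  · rw [intervalIntegral.integral_symm, abs_neg, abs_sub_comm]
    exact this hy hx (le_of_not_ge hxy)
  have hsub : Ioc x y ⊆ II := fun s hs => ⟨hx.1.trans hs.1.le, hs.2.trans hy.2⟩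
  have hfin : volII (Ioc x y) ≠ ∞ := measure_ne_top _ _
  have hin := L2.inner_indicatorConstLp_one (𝕜 := ℝ) (μ := volII) measurableSet_Ioc hfin h
  rw [Measure.restrict_restrict measurableSet_Ioc, inter_eq_self_of_subset_left hsub] at hin
  rw [intervalIntegral.integral_of_le hxy, ← hin, mul_comm]
  refine (abs_real_inner_le_norm _ _).trans (le_of_eq ?_)
  congr 1
  rw [norm_indicatorConstLp (by norm_num) (by norm_num)]
  have : volII.real (Ioc x y) = y - x := by
    rw [measureReal_def, Measure.restrict_apply measurableSet_Ioc,
      inter_eq_self_of_subset_left hsub, Real.volume_Ioc, ENNReal.toReal_ofReal (by linarith)]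
  rw [this, abs_of_nonneg (by linarith), Real.sqrt_eq_rpow]
  simp

theorem abs_J_le (h : L2II) {x : ℝ} (hx : x ∈ II) : |J h x| ≤ √2 * ‖h‖ := by
  refine (abs_integral_le_norm_mul_sqrt h neg_one_mem_ii hx).trans ?_
  rw [mul_comm]
  refine mul_le_mul_of_nonneg_right (Real.sqrt_le_sqrt ?_) (norm_nonneg _)
  rw [abs_le]
  constructor <;> linarith [hx.1, hx.2]

theorem J_add {u v : ℝ → ℝ} (hu : IntegrableOn u II) (hv : IntegrableOn v II) {x : ℝ}
    (hx : x ∈ II) : J (fun s => u s + v s) x = J u x + J v x :=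
  intervalIntegral.integral_add (intervalIntegrable_of_mem_ii hu neg_one_mem_ii hx)
    (intervalIntegrable_of_mem_ii hv neg_one_mem_ii hx)

/-- The operator `J` from `L_2([-1, 1])` to the continuous functions. -/
noncomputable def Jb : L2II →L[ℝ] (II →ᵇ ℝ) :=
  LinearMap.mkContinuous
    { toFun := fun h => mkOfCompact
        ⟨fun x => J h x, continuousOn_iff_continuous_domRestrict.1 (continuousOn_J h.integrableOn)⟩
      map_add' := fun h g => by
        ext x
        change J _ x = J _ x + J _ x
        rw [← J_add h.integrableOn g.integrableOn x.2]
        exact J_congr_ae (Lp.coeFn_add h g) x.2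
      map_smul' := fun c h => by
        ext x
        change J _ x = c * J _ x
        rw [J_congr_ae (Lp.coeFn_smul c h) x.2]
        exact intervalIntegral.integral_const_mul _ _ }
    √2 fun h => (norm_le (by positivity)).2 fun x => abs_J_le h x.2

theorem Jb_apply (h : L2II) (x : II) : Jb h x = J h x := rfl

/-- Arzelà–Ascoli: primitives of the unit ball are uniformly bounded and share the modulus of
continuity `√t`. -/
theorem isCompactOperator_Jb : IsCompactOperator Jb := by
  refine (isCompactOperator_iff_isCompact_closure_image_closedBall (Jb : L2II →ₗ[ℝ] (II →ᵇ ℝ))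
    one_pos).2 ?_
  refine arzela_ascoli (Icc (-√2) √2) isCompact_Icc _ ?_ ?_
  · rintro f x ⟨h, hh, rfl⟩
    rw [mem_closedBall_zero_iff] at hh
    refine abs_le.1 ((abs_J_le h x.2).trans ?_)
    exact mul_le_of_le_one_right (Real.sqrt_nonneg _) hh
  · refine Metric.equicontinuous_of_continuity_modulus (fun t => √t) ?_ _ ?_
    · have := Real.continuous_sqrt.tendsto 0
      rwa [Real.sqrt_zero] at this
    · rintro x y ⟨f, h, hh, rfl⟩
      rw [mem_closedBall_zero_iff] at hh
      change |J h x - J h y| ≤ √|(x : ℝ) - y|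
      rw [J_sub h.integrableOn y.2 x.2]
      exact (abs_integral_le_norm_mul_sqrt h y.2 x.2).trans
        (mul_le_of_le_one_left (Real.sqrt_nonneg _) hh)

/-- The class in `L_2([-1, 1])` of a continuous function on `[-1, 1]`. -/
noncomputable def toL2 : (II →ᵇ ℝ) →L[ℝ] L2II :=
  (BoundedContinuousFunction.toLp 2 volII ℝ).comp
    ({ toFun := fun f => f.compContinuous ⟨projIcc (-1) 1 (by norm_num), continuous_projIcc⟩
       map_add' := fun _ _ => rfl
       map_smul' := fun _ _ => rfl
       cont := continuous_compContinuous _ } : (II →ᵇ ℝ) →L[ℝ] (ℝ →ᵇ ℝ))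

theorem coeFn_toL2 (f : II →ᵇ ℝ) {g : ℝ → ℝ} (hg : ∀ x : II, f x = g x) :
    toL2 f =ᵐ[volII] g := by
  refine (BoundedContinuousFunction.coeFn_toLp 2 volII ℝ _).trans (ae_eq_of_eqOn fun x hx => ?_)
  change f (projIcc (-1) 1 (by norm_num) x) = g x
  rw [projIcc_of_mem _ hx, hg]

/-- The operator `J` on `L_2([-1, 1])`. -/
noncomputable def JL : L2II →L[ℝ] L2II := toL2.comp Jb

theorem coeFn_JL (h : L2II) : JL h =ᵐ[volII] J h := coeFn_toL2 _ fun _ => rfl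

theorem isCompactOperator_JL : IsCompactOperator JL := isCompactOperator_Jb.clm_comp toL2

theorem coeFn_JL_iterate (h : L2II) (m : ℕ) : (JL ^ m) h =ᵐ[volII] J^[m] h := by
  induction m with
  | zero => rfl
  | succ m ih =>
    rw [pow_succ', Function.iterate_succ_apply']
    exact (coeFn_JL _).trans (ae_eq_of_eqOn (J_congr_ae ih))

theorem inner_eq_integral {f g : L2II} {u v : ℝ → ℝ} (hf : f =ᵐ[volII] u) (hg : g =ᵐ[volII] v) :
    inner ℝ f g = ∫ x in (-1 : ℝ)..1, u x * v x := by
  rw [L2.inner_def, ← integral_volII]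
  refine integral_congr_ae ?_
  filter_upwards [hf, hg] with x h1 h2
  rw [h1, h2, real_inner_eq_re_inner, RCLike.inner_apply]
  simp [mul_comm]

/-- Integration by parts: `JL` is skew-adjoint up to a boundary term at `1`, which vanishes when one
of the functions has mean zero. -/
theorem inner_JL_add (h g : L2II) :
    inner ℝ h (JL g) + inner ℝ (JL h) g = J h 1 * J g 1 := by
  rw [← integral_J_mul h.integrableOn g.integrableOn,
    inner_eq_integral (Filter.EventuallyEq.refl _ _) (coeFn_JL g),
    inner_eq_integral (coeFn_JL h) (Filter.EventuallyEq.refl _ _),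
    ← intervalIntegral.integral_add]
  · exact (intervalIntegrable_of_mem_ii h.integrableOn neg_one_mem_ii one_mem_ii).mul_continuousOn
      (uIcc_neg_one_one ▸ continuousOn_J g.integrableOn)
  · exact (intervalIntegrable_of_mem_ii g.integrableOn neg_one_mem_ii one_mem_ii).continuousOn_mul
      (uIcc_neg_one_one ▸ continuousOn_J h.integrableOn)

end LandauKolmogorov

/-! ### Derivatives of iterated primitives and Taylor's formula -/

namespace LandauKolmogorov

open Polynomial

theorem uniqueDiffOn_ii : UniqueDiffOn ℝ II := uniqueDiffOn_Icc (by norm_num)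

theorem D_succ (n : ℕ) (f : ℝ → ℝ) : D (n + 1) f = D n (derivWithin f II) :=
  iteratedDerivWithin_succ'

theorem D_congr {f g : ℝ → ℝ} (n : ℕ) (h : EqOn f g II) : EqOn (D n f) (D n g) II :=
  iteratedDerivWithin_congr h

theorem hasDerivWithinAt_J {u : ℝ → ℝ} (hu : ContinuousOn u II) {x : ℝ} (hx : x ∈ II) :
    HasDerivWithinAt (J u) (u x) II x := by
  -- `J u` sees only the values of `u` on the interval, so `u` may be extended continuously to `ℝ`
  -- for the fundamental theorem of calculus.
  set v : ℝ → ℝ := IccExtend (by norm_num : (-1 : ℝ) ≤ 1) (II.domRestrict u) with hv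
  have hvc : Continuous v := (continuousOn_iff_continuous_domRestrict.1 hu).Icc_extend'
  have huv : EqOn u v II := fun y hy => by rw [hv, IccExtend_of_mem _ _ hy]; rfl
  rw [huv hx]
  exact (hvc.integral_hasStrictDerivAt (-1) x).hasDerivAt.hasDerivWithinAt.congr
    (fun y hy => J_congr huv hy) (J_congr huv hx)

theorem derivWithin_J {u : ℝ → ℝ} (hu : ContinuousOn u II) : EqOn (derivWithin (J u) II) u II :=
  fun _ hx => (hasDerivWithinAt_J hu hx).derivWithin (uniqueDiffOn_ii _ hx)

theorem contDiffOn_J {u : ℝ → ℝ} {n : ℕ} (hu : ContDiffOn ℝ n u II) :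
    ContDiffOn ℝ (n + 1 : ℕ) (J u) II := by
  rw [Nat.cast_succ, contDiffOn_succ_iff_derivWithin uniqueDiffOn_ii]
  refine ⟨fun x hx => (hasDerivWithinAt_J hu.continuousOn hx).differentiableWithinAt, ?_,
    hu.congr (derivWithin_J hu.continuousOn)⟩
  intro h
  exact absurd h (by simp)

theorem D_J {u : ℝ → ℝ} (hu : ContinuousOn u II) (n : ℕ) : EqOn (D (n + 1) (J u)) (D n u) II := by
  rw [D_succ]
  exact D_congr n (derivWithin_J hu)

theorem contDiffOn_J_iterate {u : ℝ → ℝ} {n : ℕ} (hu : ContDiffOn ℝ n u II) (m : ℕ) :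
    ContDiffOn ℝ (m + n : ℕ) (J^[m] u) II := by
  induction m with
  | zero => simpa using hu
  | succ m ih =>
    rw [Function.iterate_succ_apply', show m + 1 + n = m + n + 1 by ring]
    exact contDiffOn_J ih

theorem contDiffOn_J_iterate_zero {u : ℝ → ℝ} (hu : ContinuousOn u II) (m : ℕ) :
    ContDiffOn ℝ m (J^[m] u) II := by
  simpa using contDiffOn_J_iterate (n := 0) (by simpa using hu) m

theorem D_J_iterate {u : ℝ → ℝ} (hu : ContinuousOn u II) (m n : ℕ) :
    EqOn (D (m + n) (J^[m] u)) (D n u) II := by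
  induction m with
  | zero => rw [zero_add]; exact fun x _ => rfl
  | succ m ih =>
    rw [Function.iterate_succ_apply', show m + 1 + n = m + n + 1 by ring]
    exact (D_J (contDiffOn_J_iterate_zero hu m).continuousOn _).trans ih

theorem continuousOn_J_iterate {u : ℝ → ℝ} (hu : IntegrableOn u II) {m : ℕ} (hm : 0 < m) :
    ContinuousOn (J^[m] u) II := by
  obtain ⟨m, rfl⟩ := Nat.exists_eq_succ_of_ne_zero hm.ne'
  rw [Function.iterate_succ_apply]
  exact (contDiffOn_J_iterate_zero (continuousOn_J hu) m).continuousOn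

theorem D_J_iterate_of_lt {u : ℝ → ℝ} (hu : IntegrableOn u II) {r k : ℕ} (hk : k < r) :
    EqOn (D k (J^[r] u)) (J^[r - k] u) II := by
  have h : J^[r] u = J^[k] (J^[r - k] u) := by
    rw [← Function.iterate_add_apply, show k + (r - k) = r by omega]
  rw [h]
  simpa using D_J_iterate (continuousOn_J_iterate hu (by omega : 0 < r - k)) k 0

theorem ae_derivWithin_J {u : ℝ → ℝ} (hu : IntegrableOn u II) :
    derivWithin (J u) II =ᵐ[volII] u := by
  rw [Filter.EventuallyEq, ae_restrict_iff' measurableSet_Icc]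
  filter_upwards [(intervalIntegrable_of_mem_ii hu neg_one_mem_ii one_mem_ii).ae_hasDerivAt_integral]
    with x h1 hx
  rw [uIcc_neg_one_one] at h1
  have h2 : HasDerivAt (J u) (u x) x := h1 hx _ neg_one_mem_ii
  exact h2.hasDerivWithinAt.derivWithin (uniqueDiffOn_ii _ hx)

theorem D_polynomial (p : ℝ[X]) (n : ℕ) :
    EqOn (D n (fun x => p.eval x)) (fun x => (derivative^[n] p).eval x) II := by
  induction n generalizing p with
  | zero => intro x _; simp [D]
  | succ n ih =>
    rw [D_succ, Function.iterate_succ_apply]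
    refine (D_congr n fun x hx => ?_).trans (ih _)
    exact p.derivWithin (uniqueDiffOn_ii _ hx)

/-- The normalisation at `-1` makes `P` exactly the primitive `J` of `p`. -/
theorem exists_derivative_eq {p : ℝ[X]} {n : ℕ} (hp : p.degree < n) :
    ∃ P : ℝ[X], P.degree < (n + 1 : ℕ) ∧ derivative P = p ∧ P.eval (-1) = 0 := by
  set Q : ℝ[X] := ∑ i ∈ Finset.range n, C (p.coeff i / (i + 1)) * X ^ (i + 1) with hQ
  have hQd : Q ∈ degreeLT ℝ (n + 1) := by
    refine Submodule.sum_mem _ fun i hi => mem_degreeLT.2 ?_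
    refine (degree_C_mul_X_pow_le _ _).trans_lt ?_
    have := Finset.mem_range.1 hi
    exact_mod_cast (by omega : i + 1 < n + 1)
  refine ⟨Q - C (Q.eval (-1)), ?_, ?_, by simp⟩
  · refine mem_degreeLT.1 (Submodule.sub_mem _ hQd (mem_degreeLT.2 ?_))
    exact degree_C_le.trans_lt (by exact_mod_cast n.succ_pos)
  · rw [derivative_sub, derivative_C, sub_zero, hQ, derivative_sum]
    rcases eq_or_ne p 0 with rfl | hp0
    · simp
    · conv_rhs => rw [p.as_sum_range' n ((natDegree_lt_iff_degree_lt hp0).2 hp)]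
      refine Finset.sum_congr rfl fun i _ => ?_
      rw [derivative_C_mul_X_pow, ← C_mul_X_pow_eq_monomial]
      have : (i : ℝ) + 1 ≠ 0 := by positivity
      simp [div_mul_cancel₀ _ this]

theorem J_polynomial {P : ℝ[X]} (h : P.eval (-1) = 0) :
    J (fun x => (derivative P).eval x) = fun x => P.eval x := by
  ext x
  have := intervalIntegral.integral_eq_sub_of_hasDerivAt (a := -1) (b := x)
    (fun x _ => P.hasDerivAt x) ((derivative P).continuous.intervalIntegrable _ _)
  rw [h, sub_zero] at this
  exact this

/-- Taylor's formula with integral remainder. -/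
theorem exists_eqOn_taylor {r : ℕ} {f : ℝ → ℝ} (hf : ContDiffOn ℝ r f II)
    (hac : AbsolutelyContinuousOnInterval (D r f) (-1) 1) (hD : IntegrableOn (D (r + 1) f) II) :
    ∃ p : ℝ[X], p.degree < (r + 1 : ℕ) ∧
      EqOn f (fun x => p.eval x + J^[r + 1] (D (r + 1) f) x) II := by
  induction r generalizing f with
  | zero =>
    refine ⟨C (f (-1)), degree_C_le.trans_lt (by norm_num), fun x hx => ?_⟩
    have h0 : D 0 f = f := iteratedDerivWithin_zero
    rw [h0] at hac
    have h1 := (hac.mono (uIcc_neg_one_one ▸ ii_subset neg_one_mem_ii hx)).integral_deriv_eq_sub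
    have h2 : D (0 + 1) f =ᵐ[volII] deriv f := by
      rw [zero_add, D, iteratedDerivWithin_one, Filter.EventuallyEq,
        ae_restrict_iff' measurableSet_Icc]
      have e1 : ∀ᵐ s : ℝ, s ≠ -1 := by simp [ae_iff, measure_singleton]
      have e2 : ∀ᵐ s : ℝ, s ≠ 1 := by simp [ae_iff, measure_singleton]
      filter_upwards [e1, e2] with s h1 h2 hs
      exact derivWithin_of_mem_nhds (Icc_mem_nhds (lt_of_le_of_ne hs.1 h1.symm)
        (lt_of_le_of_ne hs.2 h2))
    beta_reduce
    rw [eval_C, Function.iterate_one, J_congr_ae h2 hx]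
    change _ = _ + ∫ s in (-1 : ℝ)..x, deriv f s
    rw [h1]
    ring
  | succ r ih =>
    have hd : ContDiffOn ℝ 1 f II := hf.of_le (by exact_mod_cast (by omega : 1 ≤ r + 1))
    have hf' : ContDiffOn ℝ r (derivWithin f II) II := by
      rw [Nat.cast_succ, contDiffOn_succ_iff_derivWithin uniqueDiffOn_ii] at hf
      exact hf.2.2
    rw [D_succ] at hac hD
    obtain ⟨p, hp, hpe⟩ := ih hf' hac hD
    obtain ⟨P, hP, hPd, hP0⟩ := exists_derivative_eq hp
    refine ⟨P + C (f (-1)), ?_, fun x hx => ?_⟩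
    · refine (degree_add_le _ _).trans_lt (max_lt hP (degree_C_le.trans_lt ?_))
      exact_mod_cast (r + 1).succ_pos
    · rw [D_succ, Function.iterate_succ_apply' J (r + 1)]
      have h1 := intervalIntegral.integral_derivWithin_Icc_of_contDiffOn_Icc
        (hd.mono (Icc_subset_Icc_right hx.2)) hx.1
      -- At interior points of `[-1, x]` both one-sided conventions give the ordinary derivative;
      -- only the point `x` has to be discarded.
      have h2 : ∫ s in (-1 : ℝ)..x, derivWithin f (Icc (-1) x) s
          = J (fun s => p.eval s + J^[r + 1] (D (r + 1) (derivWithin f II)) s) x := by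
        rw [← J_congr hpe hx]
        refine intervalIntegral.integral_congr_ae ?_
        have : ∀ᵐ s : ℝ, s ≠ x := by simp [ae_iff, measure_singleton]
        filter_upwards [this] with s hs hsx
        rw [uIoc_of_le hx.1] at hsx
        have hsx' : s < x := lt_of_le_of_ne hsx.2 hs
        rw [derivWithin_of_mem_nhds (Icc_mem_nhds hsx.1 hsx'),
          derivWithin_of_mem_nhds (Icc_mem_nhds hsx.1 (hsx'.trans_le hx.2))]
      rw [h1, J_add p.continuous.continuousOn.integrableOn_Icc
        (continuousOn_J_iterate hD r.succ_pos).integrableOn_Icc hx, ← hPd, J_polynomial hP0] at h2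
      beta_reduce at h2 ⊢
      rw [eval_add, eval_C]
      change _ = _ + J (J^[r + 1] _) x at h2
      linarith

theorem contDiffOn_polynomial (p : ℝ[X]) (n : ℕ) : ContDiffOn ℝ n (fun x => p.eval x) II :=
  by simpa only [coe_aeval_eq_eval] using (p.contDiff_aeval (𝕜 := ℝ) (R := ℝ) (n : WithTop ℕ∞)).contDiffOn

theorem eqOn_D_add_of_lt {r k : ℕ} {f u : ℝ → ℝ} {q : ℝ[X]} (hu : IntegrableOn u II)
    (h : EqOn f (fun x => q.eval x + J^[r] u x) II) (hk : k < r) :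
    EqOn (D k f) (fun x => (derivative^[k] q).eval x + J^[r - k] u x) II := by
  intro x hx
  have hJ : ContDiffOn ℝ k (J^[r] u) II := by
    have h1 : J^[r] u = J^[k] (J^[r - k] u) := by
      rw [← Function.iterate_add_apply, show k + (r - k) = r by omega]
    rw [h1]
    exact contDiffOn_J_iterate_zero (continuousOn_J_iterate hu (by omega)) k
  rw [D_congr k h hx, D, iteratedDerivWithin_fun_add hx uniqueDiffOn_ii
    (contDiffOn_polynomial q k x hx) (hJ x hx)]
  exact congrArg₂ _ (D_polynomial q k hx) (D_J_iterate_of_lt hu hk hx)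

/-- Functions of the form polynomial plus iterated primitive belong to `L_2^r`. -/
theorem memL2_of_eqOn {r : ℕ} (hr : 1 ≤ r) {f u : ℝ → ℝ} {q : ℝ[X]} (hq : q.degree < r)
    (hu : MemLp u 2 volII) (h : EqOn f (fun x => q.eval x + J^[r] u x) II) :
    MemL2 r f ∧ D r f =ᵐ[volII] u := by
  have hui := integrableOn_of_memLp_two hu
  have hlow := eqOn_D_add_of_lt hui h (by omega : r - 1 < r)
  rw [show r - (r - 1) = 1 by omega, Function.iterate_one] at hlow
  have hae : D r f =ᵐ[volII] u := by
    have h1 : D r f = derivWithin (D (r - 1) f) II := by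
      conv_lhs => rw [show r = r - 1 + 1 by omega]
      exact iteratedDerivWithin_succ
    have h0 : derivative (derivative^[r - 1] q) = 0 := by
      rw [← Function.iterate_succ_apply' (⇑(derivative : ℝ[X] →ₗ[ℝ] ℝ[X])),
        show (r - 1).succ = r by omega]
      rcases eq_or_ne q 0 with rfl | hq0
      · simp
      · exact iterate_derivative_eq_zero ((natDegree_lt_iff_degree_lt hq0).2 hq)
    -- The polynomial part of the `(r - 1)`-st derivative is constant, so only `J u` contributes to
    -- the `r`-th.
    have hc : derivative^[r - 1] q = C ((derivative^[r - 1] q).coeff 0) :=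
      eq_C_of_derivative_eq_zero h0
    rw [h1]
    refine (ae_eq_of_eqOn fun x hx => ?_).trans (ae_derivWithin_J hui)
    rw [derivWithin_congr hlow (hlow hx)]
    rw [hc]
    simp
  refine ⟨⟨?_, ?_, (memLp_congr_ae hae).2 hu⟩, hae⟩
  · refine ContDiffOn.congr ?_ h
    refine (contDiffOn_polynomial q _).add ?_
    have h1 : J^[r] u = J^[r - 1] (J u) := by
      rw [← Function.iterate_succ_apply, show (r - 1).succ = r by omega]
    rw [h1]
    exact contDiffOn_J_iterate_zero (continuousOn_J hui) (r - 1)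
  · have h2 : AbsolutelyContinuousOnInterval
        (fun x => (derivative^[r - 1] q).eval x + J u x) (-1) 1 :=
      (ContDiffOn.absolutelyContinuousOnInterval
        (uIcc_neg_one_one ▸ contDiffOn_polynomial _ 1)).fun_add (absolutelyContinuous_J hui)
    -- Absolute continuity involves only values at points of the interval, so it transfers along
    -- `hlow`.
    rw [absolutelyContinuousOnInterval_iff] at h2 ⊢
    intro ε hε
    obtain ⟨δ, hδ, hE⟩ := h2 ε hε
    refine ⟨δ, hδ, fun E hEm hlt => ?_⟩
    refine (Finset.sum_congr rfl fun i hi => ?_).trans_lt (hE E hEm hlt)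
    have hi' := hEm.1 i hi
    rw [uIcc_neg_one_one] at hi'
    rw [hlow hi'.1, hlow hi'.2]

theorem MemL2.exists_eqOn {r : ℕ} (hr : 1 ≤ r) {f : ℝ → ℝ} (hf : MemL2 r f) :
    ∃ q : ℝ[X], q.degree < r ∧ EqOn f (fun x => q.eval x + J^[r] (D r f) x) II := by
  obtain ⟨r, rfl⟩ := Nat.exists_eq_succ_of_ne_zero (Nat.one_le_iff_ne_zero.1 hr)
  exact exists_eqOn_taylor (by simpa using hf.contDiffOn) (by simpa using hf.absCont)
    (integrableOn_of_memLp_two hf.memLp)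

end LandauKolmogorov

/-! ### The operator `S†S` and its eigenvectors -/

namespace LandauKolmogorov

open Polynomial BoundedContinuousFunction

/-- The class in `L_2([-1, 1])` of a polynomial. -/
noncomputable def polyL2 : ℝ[X] →ₗ[ℝ] L2II :=
  (toL2 : (II →ᵇ ℝ) →ₗ[ℝ] L2II).comp
    ({ toFun := fun p => mkOfCompact
          ⟨fun x : II => p.eval (x : ℝ), p.continuous.comp continuous_subtype_val⟩
       map_add' := fun p q => by ext x; simp
       map_smul' := fun c p => by ext x; simp } : ℝ[X] →ₗ[ℝ] (II →ᵇ ℝ))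

theorem coeFn_polyL2 (p : ℝ[X]) : polyL2 p =ᵐ[volII] fun x => p.eval x :=
  coeFn_toL2 (mkOfCompact ⟨fun x : II => p.eval (x : ℝ), p.continuous.comp continuous_subtype_val⟩)
    fun _ => rfl

/-- The class in `L_2([-1, 1])` of a Legendre polynomial. -/
noncomputable def legL2 (j : ℕ) : L2II := polyL2 (legendrePoly j)

theorem inner_legL2 {i j : ℕ} (h : i ≠ j) : inner ℝ (legL2 i) (legL2 j) = 0 := by
  rw [legL2, legL2, inner_eq_integral (coeFn_polyL2 _) (coeFn_polyL2 _)]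
  exact integral_legendrePoly_mul h

/-- The orthogonal projection onto the polynomials of degree less than `r`. -/
noncomputable def projPoly (r : ℕ) (v : L2II) : ℝ[X] :=
  ∑ j ∈ Finset.range r, (inner ℝ (legL2 j) v / ‖legL2 j‖ ^ 2) • legendrePoly j

theorem sum_smul_legendrePoly_degree_lt (r : ℕ) (c : ℕ → ℝ) :
    (∑ j ∈ Finset.range r, c j • legendrePoly j).degree < r := by
  refine mem_degreeLT.1 (Submodule.sum_mem _ fun j hj => Submodule.smul_mem _ _ ?_)
  rw [mem_degreeLT, legendrePoly_degree]
  exact_mod_cast Finset.mem_range.1 hj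

theorem projPoly_degree_lt (r : ℕ) (v : L2II) : (projPoly r v).degree < r :=
  sum_smul_legendrePoly_degree_lt r _

/-- `(1 - Π) J^r` with `Π` the projection onto the polynomials of degree less than `r`. -/
noncomputable def S (r : ℕ) : L2II →L[ℝ] L2II :=
  (ContinuousLinearMap.id ℝ L2II - ∑ j ∈ Finset.range r,
    ((‖legL2 j‖ ^ 2)⁻¹ • innerSL ℝ (legL2 j)).smulRight (legL2 j)).comp (JL ^ r)

theorem S_apply (r : ℕ) (h : L2II) : S r h = (JL ^ r) h - polyL2 (projPoly r ((JL ^ r) h)) := by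
  simp only [S, projPoly, map_sum, map_smul, ContinuousLinearMap.comp_apply,
    _root_.sub_apply, _root_.sum_apply,
    ContinuousLinearMap.smulRight_apply, _root_.smul_apply, innerSL_apply_apply,
    smul_eq_mul, ContinuousLinearMap.id_apply, div_eq_inv_mul]
  rfl

theorem inner_sum_smul_legL2 {r j : ℕ} (hj : j < r) (c : ℕ → ℝ) :
    inner ℝ (legL2 j) (polyL2 (∑ i ∈ Finset.range r, c i • legendrePoly i))
      = c j * ‖legL2 j‖ ^ 2 := by
  rw [map_sum, inner_sum, Finset.sum_eq_single_of_mem j (Finset.mem_range.2 hj)]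
  · rw [map_smul, real_inner_smul_right]
    exact congrArg _ (real_inner_self_eq_norm_sq _)
  · intro i _ hij
    rw [map_smul, real_inner_smul_right]
    exact mul_eq_zero_of_right _ (inner_legL2 hij.symm)

theorem inner_legL2_S {r j : ℕ} (hj : j < r) (h : L2II) : inner ℝ (legL2 j) (S r h) = 0 := by
  rw [S_apply, inner_sub_right, projPoly, inner_sum_smul_legL2 hj]
  -- Splitting here avoids having to prove that the Legendre class is nonzero.
  rcases eq_or_ne (legL2 j) 0 with h0 | h0
  · simp [h0]
  · rw [div_mul_cancel₀ _ (by simpa using h0), sub_self]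

theorem inner_S_poly {r : ℕ} (h : L2II) {p : ℝ[X]} (hp : p.degree < r) :
    inner ℝ (S r h) (polyL2 p) = 0 := by
  obtain ⟨c, rfl⟩ := exists_sum_legendrePoly hp
  rw [map_sum, inner_sum]
  refine Finset.sum_eq_zero fun j hj => ?_
  rw [map_smul, real_inner_smul_right, real_inner_comm]
  exact mul_eq_zero_of_right _ (inner_legL2_S (Finset.mem_range.1 hj) h)

theorem isCompactOperator_S {r : ℕ} (hr : 1 ≤ r) : IsCompactOperator (S r) := by
  obtain ⟨r, rfl⟩ := Nat.exists_eq_succ_of_ne_zero (Nat.one_le_iff_ne_zero.1 hr)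
  have h : IsCompactOperator (JL ^ (r + 1)) := by
    rw [pow_succ']
    exact isCompactOperator_JL.comp_clm (JL ^ r)
  rw [S]
  exact h.clm_comp (ContinuousLinearMap.id ℝ L2II - ∑ j ∈ Finset.range (r + 1),
    ((‖legL2 j‖ ^ 2)⁻¹ • innerSL ℝ (legL2 j)).smulRight (legL2 j))

/-- The operator `S† S`. -/
noncomputable def T (r : ℕ) : L2II →L[ℝ] L2II := (ContinuousLinearMap.adjoint (S r)).comp (S r)

theorem inner_T (r : ℕ) (h g : L2II) : inner ℝ (T r h) g = inner ℝ (S r h) (S r g) := by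
  rw [T, ContinuousLinearMap.comp_apply, ContinuousLinearMap.adjoint_inner_left]

theorem isSymmetric_T (r : ℕ) : (T r).IsSymmetric := by
  intro h g
  change inner ℝ (T r h) g = inner ℝ h (T r g)
  rw [inner_T, real_inner_comm, ← inner_T, real_inner_comm]

theorem isCompactOperator_T {r : ℕ} (hr : 1 ≤ r) : IsCompactOperator (T r) :=
  (isCompactOperator_S hr).clm_comp (ContinuousLinearMap.adjoint (S r))

/-- The continuous representative of `S r h`. -/
noncomputable def Sf (r : ℕ) (h : L2II) (x : ℝ) : ℝ :=
  (-projPoly r ((JL ^ r) h)).eval x + J^[r] h x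

theorem coeFn_S (r : ℕ) (h : L2II) : S r h =ᵐ[volII] Sf r h := by
  rw [S_apply]
  filter_upwards [Lp.coeFn_sub ((JL ^ r) h) (polyL2 (projPoly r ((JL ^ r) h))),
    coeFn_JL_iterate h r, coeFn_polyL2 (projPoly r ((JL ^ r) h))] with x h1 h2 h3
  rw [h1, Pi.sub_apply, h2, h3, Sf, eval_neg]
  ring

theorem D_Sf {r k : ℕ} (hk : k < r) (h : L2II) :
    EqOn (D k (Sf r h))
      (fun x => (derivative^[k] (-projPoly r ((JL ^ r) h))).eval x + J^[r - k] h x) II :=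
  eqOn_D_add_of_lt h.integrableOn (fun _ _ => rfl) hk

theorem continuousOn_D_Sf {r k : ℕ} (hk : k < r) (h : L2II) : ContinuousOn (D k (Sf r h)) II :=
  ContinuousOn.congr (((Polynomial.continuous _).continuousOn).add
    (continuousOn_J_iterate h.integrableOn (by omega))) (D_Sf hk h)

/-- Pointwise evaluation of the `k`-th derivative of `S r h` is continuous in `h`. -/
theorem exists_clm_D_Sf {r k : ℕ} (hk : k < r) {t : ℝ} (ht : t ∈ II) :
    ∃ L : L2II →L[ℝ] ℝ, ∀ h, L h = D k (Sf r h) t := by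
  refine ⟨(BoundedContinuousFunction.evalCLM ℝ (⟨t, ht⟩ : II)).comp (Jb.comp (JL ^ (r - k - 1)))
    - ∑ j ∈ Finset.range r, ((‖legL2 j‖ ^ 2)⁻¹ * (derivative^[k] (legendrePoly j)).eval t) •
      (innerSL ℝ (legL2 j)).comp (JL ^ r), fun h => ?_⟩
  rw [D_Sf hk h ht]
  -- Point evaluation makes no sense on `L_2`; the last of the `r - k ≥ 1` primitives is therefore
  -- taken with values in continuous functions.
  have h1 : J^[r - k] h t = Jb ((JL ^ (r - k - 1)) h) ⟨t, ht⟩ := by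
    rw [Jb_apply, J_congr_ae (coeFn_JL_iterate h _) ht, ← Function.iterate_succ_apply' J,
      show (r - k - 1).succ = r - k by omega]
  beta_reduce
  rw [h1, projPoly, ← Finset.sum_neg_distrib, iterate_derivative_sum, eval_finsetSum,
    _root_.sub_apply, _root_.sum_apply, sub_eq_neg_add,
    ← Finset.sum_neg_distrib]
  congr 1
  refine Finset.sum_congr rfl fun j _ => ?_
  rw [iterate_derivative_neg, iterate_derivative_smul, eval_neg, eval_smul]
  simp only [_root_.smul_apply, ContinuousLinearMap.comp_apply, innerSL_apply_apply,
    smul_eq_mul]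
  ring

theorem ofReal_abs_le_nrm_top {g : ℝ → ℝ} (hg : ContinuousOn g II) {t : ℝ} (ht : t ∈ II) :
    ENNReal.ofReal |g t| ≤ nrm ∞ g := by
  rcases eq_or_ne (nrm ∞ g) ∞ with h | h
  · rw [h]; exact le_top
  have h1 : ∀ᵐ y ∂volII, ‖g y‖ₑ ≤ nrm ∞ g := by
    rw [nrm, eLpNorm_exponent_top]
    exact ae_le_eLpNormEssSup
  -- Truncating at the essential supremum changes `|g|` only on a null set; both functions are
  -- continuous, hence equal everywhere on the interval.
  have h2 : (fun y => min |g y| (nrm ∞ g).toReal) =ᵐ[volII] fun y => |g y| := by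
    filter_upwards [h1] with y hy
    refine min_eq_left ?_
    rw [← ofReal_norm, Real.norm_eq_abs] at hy
    exact (ENNReal.ofReal_le_iff_le_toReal h).1 hy
  have h3 := Measure.eqOn_Icc_of_ae_eq (μ := volume) (by norm_num : (-1 : ℝ) ≠ 1) h2
    (ContinuousOn.inf hg.abs continuousOn_const) hg.abs ht
  exact (ENNReal.ofReal_le_iff_le_toReal h).2 (min_eq_left_iff.1 h3)

theorem nrm_top_le {g : ℝ → ℝ} {M : ℝ} (h : ∀ t ∈ II, |g t| ≤ M) : nrm ∞ g ≤ ENNReal.ofReal M := by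
  rw [nrm, eLpNorm_exponent_top]
  exact eLpNormEssSup_le_of_ae_bound
    ((ae_restrict_iff' measurableSet_Icc).2 (Filter.Eventually.of_forall h))

theorem JL_polyL2 {P : ℝ[X]} (h : P.eval (-1) = 0) : JL (polyL2 (derivative P)) = polyL2 P := by
  refine Lp.ext ((coeFn_JL _).trans ?_)
  refine (ae_eq_of_eqOn (J_congr_ae (coeFn_polyL2 _))).trans ?_
  rw [J_polynomial h]
  exact (coeFn_polyL2 P).symm

/-- If `u` is orthogonal to the polynomials of degree less than `s`, then its iterated primitives
up to order `s` vanish at `1`, and `J^s` can be moved across the inner product. -/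
theorem JL_pow_of_orthogonal {s : ℕ} {u : L2II}
    (hu : ∀ p : ℝ[X], p.degree < s → inner ℝ u (polyL2 p) = 0) :
    (∀ g, inner ℝ u ((JL ^ s) g) = (-1) ^ s * inner ℝ ((JL ^ s) u) g) ∧
      ∀ m, 1 ≤ m → m ≤ s → J^[m] u 1 = 0 := by
  induction s generalizing u with
  | zero => exact ⟨fun g => by simp, fun m h1 h2 => by omega⟩
  | succ s ih =>
    have hu1 : J u 1 = 0 := by
      have h1 := hu 1 (degree_one.trans_lt (by exact_mod_cast s.succ_pos))
      rw [inner_eq_integral (Filter.EventuallyEq.refl _ _) (coeFn_polyL2 1)] at h1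
      simpa [J] using h1
    have hJ : ∀ g, inner ℝ u (JL g) = -inner ℝ (JL u) g := by
      intro g
      have := inner_JL_add u g
      rw [hu1, zero_mul] at this
      linarith
    -- Orthogonality passes to `J u` with one degree lost: write `p = P'` with `P(-1) = 0` and
    -- integrate by parts.
    have hu' : ∀ p : ℝ[X], p.degree < s → inner ℝ (JL u) (polyL2 p) = 0 := by
      intro p hp
      obtain ⟨P, hP, rfl, hP0⟩ := exists_derivative_eq hp
      have := hJ (polyL2 (derivative P))
      rw [JL_polyL2 hP0, hu P hP] at this
      linarith
    obtain ⟨ih1, ih2⟩ := ih hu'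
    refine ⟨fun g => ?_, fun m h1 h2 => ?_⟩
    · rw [pow_succ' JL, mul_apply_eq_comp, hJ, ih1, ← mul_apply_eq_comp,
        ← pow_succ, ← pow_succ' JL, pow_succ]
      ring
    · obtain ⟨m, rfl⟩ := Nat.exists_eq_succ_of_ne_zero (Nat.one_le_iff_ne_zero.1 h1)
      rcases Nat.eq_zero_or_pos m with rfl | hm
      · exact hu1
      · have h3 := ih2 m hm (by omega)
        obtain ⟨m, rfl⟩ := Nat.exists_eq_succ_of_ne_zero hm.ne'
        rw [Function.iterate_succ_apply] at h3 ⊢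
        rw [Function.iterate_succ_apply]
        rw [← J_iterate_congr (J_congr_ae (coeFn_JL u)) m one_mem_ii]
        exact h3

theorem J_iterate_congr_ae {u v : ℝ → ℝ} (h : u =ᵐ[volII] v) {m : ℕ} (hm : 1 ≤ m) :
    EqOn (J^[m] u) (J^[m] v) II := by
  obtain ⟨m, rfl⟩ := Nat.exists_eq_succ_of_ne_zero (Nat.one_le_iff_ne_zero.1 hm)
  rw [Function.iterate_succ_apply, Function.iterate_succ_apply]
  exact J_iterate_congr (J_congr_ae h) m

/-- An eigenvector of `S† S` with positive eigenvalue is, up to a null set, the iterated primitive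
of a multiple of its image under `S`, and this primitive is an eigenfunction of the boundary value
problem. -/
theorem exists_isEigenfunction {r : ℕ} (hr : 1 ≤ r) {x : L2II} {μ : ℝ} (hμ : 0 < μ) (hx0 : x ≠ 0)
    (hx : T r x = μ • x) :
    ∃ φ : ℝ → ℝ, IsEigenfunction r μ⁻¹ φ ∧
      ∀ k < r, EqOn (D (r + k) φ) (fun t => ((-1) ^ r * μ⁻¹) * D k (Sf r x) t) II := by
  set c : ℝ := (-1) ^ r * μ⁻¹ with hc
  set v : ℝ → ℝ := fun t => c * Sf r x t with hv
  set u : L2II := c • S r x with hu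
  have huv : u =ᵐ[volII] v := by
    filter_upwards [Lp.coeFn_smul c (S r x), coeFn_S r x] with t h1 h2
    rw [h1, Pi.smul_apply, h2, smul_eq_mul]
  have hup : ∀ p : ℝ[X], p.degree < r → inner ℝ u (polyL2 p) = 0 := fun p hp => by
    rw [hu, real_inner_smul_left, inner_S_poly x hp, mul_zero]
  obtain ⟨hadj, hzero⟩ := JL_pow_of_orthogonal hup
  have hsq : ((-1 : ℝ) ^ r) * (-1) ^ r = 1 := by rw [← mul_pow]; simp
  -- Weak form of the eigenvalue equation: `μ ⟨x, g⟩ = ⟨S x, S g⟩ = ⟨S x, J^r g⟩`, because `S x` is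
  -- orthogonal to polynomials; moving `J^r` across costs the sign `(-1)^r` contained in `c`.
  have hxu : x = (JL ^ r) u := by
    refine ext_inner_right ℝ fun g => ?_
    have h1 : inner ℝ (S r x) ((JL ^ r) g) = μ * inner ℝ x g := by
      rw [← real_inner_smul_left, ← hx, inner_T, S_apply r g, inner_sub_right,
        inner_S_poly x (projPoly_degree_lt r _), sub_zero]
    have h2 := hadj g
    rw [hu, real_inner_smul_left, h1, ← hu, hc] at h2
    have h3 : inner ℝ ((JL ^ r) u) g
        = (((-1 : ℝ) ^ r) * (-1) ^ r) * inner ℝ ((JL ^ r) u) g := by rw [hsq, one_mul]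
    rw [h3, mul_assoc, ← h2]
    calc inner ℝ x g = ((-1 : ℝ) ^ r * (-1) ^ r) * (μ⁻¹ * μ) * inner ℝ x g := by
          rw [hsq, inv_mul_cancel₀ hμ.ne']; ring
      _ = _ := by ring
  set φ : ℝ → ℝ := J^[r] v with hφ
  have hxφ : x =ᵐ[volII] φ := by
    conv_lhs => rw [hxu]
    exact (coeFn_JL_iterate u r).trans (ae_eq_of_eqOn (J_iterate_congr_ae huv hr))
  have hSf : EqOn (Sf r x) (fun t => (-projPoly r ((JL ^ r) x)).eval t + J^[r] φ t) II := by
    intro t ht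
    simp only [Sf]
    rw [J_iterate_congr_ae hxφ hr ht]
  have hvc0 : ContinuousOn v II := by
    have := continuousOn_D_Sf (k := 0) (by omega : 0 < r) x
    have h0 : D 0 (Sf r x) = Sf r x := iteratedDerivWithin_zero
    rw [h0] at this
    exact continuousOn_const.mul this
  -- Bootstrap: `v` continuous makes `φ` of class `C^r`; `S x` is a polynomial plus `J^r φ`, so `v`
  -- is also `C^r`, and then `φ = J^r v` is `C^(2r)`.
  have hφc : ContDiffOn ℝ r φ II := contDiffOn_J_iterate_zero hvc0 r
  have hJφ : ContDiffOn ℝ r (J^[r] φ) II := contDiffOn_J_iterate_zero hφc.continuousOn r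
  have hSfc : ContDiffOn ℝ r (Sf r x) II := ((contDiffOn_polynomial _ r).add hJφ).congr hSf
  have hvc : ContDiffOn ℝ r v II := contDiffOn_const.mul hSfc
  have hDv : ∀ n, D n v = fun t => c * D n (Sf r x) t := fun n => by
    ext t
    exact iteratedDerivWithin_const_mul_field c (Sf r x)
  have hDφ : ∀ n, EqOn (D (r + n) φ) (fun t => c * D n (Sf r x) t) II := fun n => by
    rw [← hDv]
    exact D_J_iterate hvc0 r n
  have hDr : EqOn (D r (Sf r x)) φ II := by
    intro t ht
    rw [D_congr r hSf ht, D, iteratedDerivWithin_fun_add ht uniqueDiffOn_ii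
      (contDiffOn_polynomial _ r t ht) (hJφ t ht)]
    have h1 : derivative^[r] (-projPoly r ((JL ^ r) x)) = 0 := by
      rcases eq_or_ne (-projPoly r ((JL ^ r) x)) 0 with h0 | h0
      · rw [h0]; simp
      · refine iterate_derivative_eq_zero ((natDegree_lt_iff_degree_lt h0).2 ?_)
        rw [degree_neg]
        exact projPoly_degree_lt r _
    have h2 := D_polynomial (-projPoly r ((JL ^ r) x)) r ht
    have h3 := D_J_iterate hφc.continuousOn r 0 ht
    have h4 : D 0 φ = φ := iteratedDerivWithin_zero
    rw [h1] at h2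
    rw [add_zero, h4] at h3
    simp only [D] at h2 h3
    rw [h2, h3]
    simp
  have hlow : ∀ s < r, EqOn (D s φ) (J^[r - s] v) II := fun s hs =>
    D_J_iterate_of_lt hvc0.integrableOn_Icc hs
  refine ⟨φ, ⟨inv_pos.2 hμ, ?_, ?_, ?_, ?_, ?_⟩, fun k _ => hDφ k⟩
  · have := contDiffOn_J_iterate hvc r
    rw [← two_mul] at this
    exact_mod_cast this
  · by_contra! hne
    refine hx0 (Lp.ext ?_)
    refine (hxφ.trans (ae_eq_of_eqOn fun t ht => hne t ht)).trans ?_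
    exact (Lp.coeFn_zero ℝ 2 volII).symm
  · intro t ht
    have ht' : t ∈ II := Ioo_subset_Icc_self ht
    rw [two_mul, hDφ r ht']
    beta_reduce
    rw [hDr ht', hc, ← mul_assoc, ← mul_assoc, hsq, one_mul]
  · intro s hs
    rw [hlow s hs neg_one_mem_ii]
    obtain ⟨m, hm⟩ : ∃ m, r - s = m + 1 := ⟨r - s - 1, by omega⟩
    rw [hm, Function.iterate_succ_apply']
    exact J_neg_one _
  -- At `-1` the primitives vanish by construction; at `1` they vanish because `u` is orthogonal to
  -- polynomials of degree below `r`.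
  · intro s hs
    rw [hlow s hs one_mem_ii, ← J_iterate_congr_ae huv (by omega : 1 ≤ r - s) one_mem_ii]
    exact hzero _ (by omega) (by omega)

/-- From `μ ‖x‖^2 = ‖S x‖^2`, either `S x = 0` and there is nothing to prove, or `μ > 0`. In the
latter case the `k`-th derivative of `S x` is a nonzero multiple of `φ^(r+k)` for an eigenfunction
`φ`. -/
theorem abs_D_Sf_le_of_eigenvector {r k : ℕ} (hk : k < r)
    (hφ : ∀ (lam : ℝ) (φ : ℝ → ℝ), IsEigenfunction r lam φ →
      nrm ∞ (D (r + k) φ) = ENNReal.ofReal |D (r + k) φ (-1)|)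
    {x : L2II} {μ : ℝ} (hx : T r x = μ • x) {t : ℝ} (ht : t ∈ II) :
    |D k (Sf r x) t| ≤ |D k (Sf r x) (-1)| := by
  have hin : μ * ‖x‖ ^ 2 = ‖S r x‖ ^ 2 := by
    rw [← real_inner_self_eq_norm_sq, ← real_inner_self_eq_norm_sq, ← inner_T, hx,
      real_inner_smul_left]
  rcases eq_or_ne (S r x) 0 with hS | hS
  · have h1 : Sf r x =ᵐ[volII] fun _ => 0 :=
      (coeFn_S r x).symm.trans (hS ▸ Lp.coeFn_zero ℝ 2 volII)
    have h2 : ContinuousOn (Sf r x) II := by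
      have := continuousOn_D_Sf (k := 0) (by omega : 0 < r) x
      rwa [D, iteratedDerivWithin_zero] at this
    have h3 := Measure.eqOn_Icc_of_ae_eq (μ := volume) (by norm_num : (-1 : ℝ) ≠ 1) h1 h2
      continuousOn_const
    rw [D_congr k h3 ht]
    have h4 := D_polynomial 0 k ht
    simp only [eval_zero, iterate_derivative_zero] at h4
    rw [h4, abs_zero]
    exact abs_nonneg _
  · have hpos : 0 < ‖S r x‖ ^ 2 := by positivity
    have hx0 : x ≠ 0 := by
      rintro rfl
      exact hS (map_zero _)
    have hμ : 0 < μ := by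
      rw [← hin] at hpos
      exact pos_of_mul_pos_left hpos (sq_nonneg _)
    obtain ⟨φ, hφe, hφD⟩ := exists_isEigenfunction (by omega : 1 ≤ r) hμ hx0 hx
    have hcont : ContinuousOn (D (r + k) φ) II :=
      ContinuousOn.congr (continuousOn_const.mul (continuousOn_D_Sf hk x)) (hφD k hk)
    have h1 := ofReal_abs_le_nrm_top hcont ht
    rw [hφ _ _ hφe, ENNReal.ofReal_le_ofReal_iff (abs_nonneg _), hφD k hk ht,
      hφD k hk neg_one_mem_ii] at h1
    beta_reduce at h1
    rw [abs_mul ((-1 : ℝ) ^ r * μ⁻¹), abs_mul ((-1 : ℝ) ^ r * μ⁻¹)] at h1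
    refine le_of_mul_le_mul_left h1 (abs_pos.2 ?_)
    exact mul_ne_zero (pow_ne_zero _ (by norm_num)) (inv_ne_zero hμ.ne')

end LandauKolmogorov

/-! ### Synthesis from coefficients and the sign rearrangement -/

namespace LandauKolmogorov

open Polynomial

/-- The function with Legendre coefficients `c` and `r`-th derivative `h`. -/
noncomputable def synth (r : ℕ) (c : ℕ → ℝ) (h : L2II) (x : ℝ) : ℝ :=
  (∑ j ∈ Finset.range r, c j • legendrePoly j).eval x + Sf r h x

theorem synth_eq (r : ℕ) (c : ℕ → ℝ) (h : L2II) :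
    synth r c h = fun x => (∑ j ∈ Finset.range r, c j • legendrePoly j
      - projPoly r ((JL ^ r) h)).eval x + J^[r] h x := by
  ext x
  simp only [synth, Sf, eval_sub, eval_neg]
  ring

theorem memL2_synth {r : ℕ} (hr : 1 ≤ r) (c : ℕ → ℝ) (h : L2II) :
    MemL2 r (synth r c h) ∧ D r (synth r c h) =ᵐ[volII] h := by
  refine memL2_of_eqOn hr (mem_degreeLT.1 (Submodule.sub_mem _
    (mem_degreeLT.2 (sum_smul_legendrePoly_degree_lt r c))
    (mem_degreeLT.2 (projPoly_degree_lt r ((JL ^ r) h))))) (Lp.memLp h) ?_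
  rw [synth_eq]
  exact fun _ _ => rfl

theorem nrm_eq_enorm {f : ℝ → ℝ} {h : L2II} (hf : f =ᵐ[volII] h) : nrm 2 f = ‖h‖ₑ := by
  rw [nrm, eLpNorm_congr_ae hf, Lp.enorm_def]

/-- Pythagoras, applied to the Legendre terms and to `S h`. The coefficients enter only through
their squares and `h` only through the quadratic form, so sign changes leave the norm unchanged. -/
theorem nrm_synth (r : ℕ) (c : ℕ → ℝ) (h : L2II) :
    nrm 2 (synth r c h) = ENNReal.ofReal
      √(∑ j ∈ Finset.range r, c j ^ 2 * ‖legL2 j‖ ^ 2 + inner ℝ (T r h) h) := by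
  set q : ℝ[X] := ∑ j ∈ Finset.range r, c j • legendrePoly j with hq
  have hae : synth r c h =ᵐ[volII] (polyL2 q + S r h : L2II) := by
    filter_upwards [Lp.coeFn_add (polyL2 q) (S r h), coeFn_polyL2 q, coeFn_S r h] with x h1 h2 h3
    rw [h1, Pi.add_apply, h2, h3, synth]
  have hqq : ‖polyL2 q‖ ^ 2 = ∑ j ∈ Finset.range r, c j ^ 2 * ‖legL2 j‖ ^ 2 := by
    rw [← real_inner_self_eq_norm_sq]
    conv_lhs => enter [2]; rw [hq, map_sum]
    rw [sum_inner]
    refine Finset.sum_congr rfl fun j hj => ?_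
    have h1 := inner_sum_smul_legL2 (Finset.mem_range.1 hj) c
    rw [map_smul, real_inner_smul_left]
    change _ * inner ℝ (legL2 j) _ = _
    rw [hq, h1]
    ring
  have hort : inner ℝ (polyL2 q) (S r h) = 0 := by
    rw [real_inner_comm]
    exact inner_S_poly h (sum_smul_legendrePoly_degree_lt r c)
  rw [nrm_eq_enorm hae, ← ofReal_norm, inner_T, real_inner_self_eq_norm_sq, ← hqq]
  congr 1
  rw [eq_comm, Real.sqrt_eq_iff_mul_self_eq (by positivity) (norm_nonneg _),
    norm_add_mul_self_real, hort]
  ring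

theorem D_synth {r k : ℕ} (hk : k < r) (c : ℕ → ℝ) (h : L2II) {t : ℝ} (ht : t ∈ II) :
    D k (synth r c h) t = ∑ j ∈ Finset.range r, c j * (derivative^[k] (legendrePoly j)).eval t
      + D k (Sf r h) t := by
  have h1 := eqOn_D_add_of_lt h.integrableOn (f := synth r c h) (fun x _ => congrFun (synth_eq r c h) x)
    hk ht
  have h2 := D_Sf hk h ht
  beta_reduce at h1 h2
  rw [h1, h2, iterate_derivative_sub, eval_sub, iterate_derivative_neg, eval_neg,
    iterate_derivative_sum, eval_finsetSum]
  simp only [iterate_derivative_smul, eval_smul, smul_eq_mul]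
  ring

theorem MemL2.exists_synth {r : ℕ} (hr : 1 ≤ r) {f : ℝ → ℝ} (hf : MemL2 r f) :
    ∃ (c : ℕ → ℝ) (h : L2II), D r f =ᵐ[volII] h ∧ EqOn f (synth r c h) II := by
  obtain ⟨q, hq, hfq⟩ := hf.exists_eqOn hr
  set h : L2II := hf.memLp.toLp (D r f) with hh
  have hae : D r f =ᵐ[volII] h := hf.memLp.coeFn_toLp.symm
  -- The projection subtracted in `S h` is added back to the Taylor polynomial before expanding.
  obtain ⟨c, hc⟩ := exists_sum_legendrePoly (mem_degreeLT.1 (Submodule.add_mem _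
    (mem_degreeLT.2 hq) (mem_degreeLT.2 (projPoly_degree_lt r ((JL ^ r) h)))))
  refine ⟨c, h, hae, fun x hx => ?_⟩
  rw [hfq hx, synth_eq, ← hc]
  beta_reduce
  rw [J_iterate_congr_ae hae hr hx, add_sub_cancel_right]

/-- A sign of `a`, nonzero also at `0`. -/
noncomputable def sgn (a : ℝ) : ℝ := if 0 ≤ a then 1 else -1

theorem sgn_sq (a : ℝ) : sgn a ^ 2 = 1 := by
  unfold sgn; split_ifs <;> norm_num

theorem sgn_mul_self (a : ℝ) : sgn a * a = |a| := by
  unfold sgn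
  split_ifs with h
  · rw [one_mul, abs_of_nonneg h]
  · rw [abs_of_neg (not_le.1 h)]; ring

/-- Every function of `L_2^r` can be rearranged, preserving the norms of the function and of its
`r`-th derivative, so that the `k`-th derivative at `-1` dominates the `k`-th derivative of the
given function everywhere. -/
theorem exists_dominating {r k : ℕ} (hk : k < r)
    (hφ : ∀ (lam : ℝ) (φ : ℝ → ℝ), IsEigenfunction r lam φ →
      nrm ∞ (D (r + k) φ) = ENNReal.ofReal |D (r + k) φ (-1)|)
    {f : ℝ → ℝ} (hf : MemL2 r f) :
    ∃ g, MemL2 r g ∧ nrm 2 g = nrm 2 f ∧ nrm 2 (D r g) = nrm 2 (D r f) ∧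
      ∀ t ∈ II, |D k f t| ≤ |D k g (-1)| := by
  have hr : 1 ≤ r := by omega
  obtain ⟨c, h, hae, hfs⟩ := hf.exists_synth hr
  obtain ⟨x, hx, hsum, hsign⟩ := exists_hasSum_eigenvectors (isCompactOperator_T hr)
    (isSymmetric_T r) h
  obtain ⟨L, hL⟩ := exists_clm_D_Sf hk neg_one_mem_ii
  -- Signs are chosen so that every eigencomponent contributes its absolute value to the `k`-th
  -- derivative at `-1`.
  obtain ⟨h', hsum', hnorm, hquad⟩ := hsign (fun μ => sgn (L (x μ))) fun μ => sgn_sq _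
  set d : ℕ → ℝ := fun j => c j * (derivative^[k] (legendrePoly j)).eval (-1) with hd
  set c' : ℕ → ℝ := fun j => sgn (d j) * c j with hc'
  have hL' : HasSum (fun μ => |L (x μ)|) (L h') := by
    have := hsum'.mapL L
    simpa only [map_smul, smul_eq_mul, sgn_mul_self] using this
  -- Evaluation at `t` is a continuous functional, so it can be summed over the eigencomponents and
  -- compared with the series at `-1` term by term.
  have hSle : ∀ t ∈ II, |D k (Sf r h) t| ≤ L h' := by
    intro t ht
    obtain ⟨Lt, hLt⟩ := exists_clm_D_Sf hk ht
    have h1 : HasSum (fun μ => Lt (x μ)) (Lt h) := hsum.mapL Lt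
    have h2 : ∀ μ, |Lt (x μ)| ≤ |L (x μ)| := fun μ => by
      rw [hLt, hL]
      exact abs_D_Sf_le_of_eigenvector hk hφ (hx μ) ht
    rw [← hLt, abs_le]
    exact ⟨hasSum_le (fun μ => neg_le_of_abs_le (h2 μ)) hL'.neg h1,
      hasSum_le (fun μ => le_of_abs_le (h2 μ)) h1 hL'⟩
  obtain ⟨hg, hgD⟩ := memL2_synth hr c' h'
  refine ⟨synth r c' h', hg, ?_, ?_, fun t ht => ?_⟩
  · have hff : nrm 2 f = nrm 2 (synth r c h) := eLpNorm_congr_ae (ae_eq_of_eqOn hfs)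
    rw [hff, nrm_synth, nrm_synth, hquad]
    simp only [hc', mul_pow, sgn_sq, one_mul]
  · rw [nrm_eq_enorm hgD, nrm_eq_enorm hae, ← ofReal_norm, ← ofReal_norm, hnorm]
  · rw [D_congr k hfs ht, D_synth hk c h ht, D_synth hk c' h' neg_one_mem_ii, ← hL h']
    refine le_trans ?_ (le_abs_self _)
    refine (abs_add_le _ _).trans (add_le_add ?_ (hSle t ht))
    refine (Finset.abs_sum_le_sum_abs _ _).trans (Finset.sum_le_sum fun j _ => ?_)
    have : c' j * (derivative^[k] (legendrePoly j)).eval (-1) = |d j| := by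
      rw [← sgn_mul_self, hc', hd]
      ring
    rw [this, hd, abs_mul, abs_mul]
    exact mul_le_mul_of_nonneg_left (abs_eval_iterate_derivative_legendrePoly_le j k ht)
      (abs_nonneg _)

theorem MemL2.continuousOn_D {r k : ℕ} (hk : k < r) {f : ℝ → ℝ} (hf : MemL2 r f) :
    ContinuousOn (D k f) II :=
  hf.contDiffOn.continuousOn_iteratedDerivWithin (by exact_mod_cast (by omega : k ≤ r - 1))
    uniqueDiffOn_ii

theorem MemL2.nrm_top_ne_top {r k : ℕ} (hk : k < r) {f : ℝ → ℝ} (hf : MemL2 r f) :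
    nrm ∞ (D k f) ≠ ∞ := by
  obtain ⟨M, hM⟩ := isCompact_Icc.exists_bound_of_continuousOn (hf.continuousOn_D hk)
  exact ne_top_of_le_ne_top ENNReal.ofReal_ne_top (nrm_top_le hM)

theorem MemL2.abs_D_le {r k : ℕ} (hk : k < r) {f : ℝ → ℝ} (hf : MemL2 r f) {t : ℝ} (ht : t ∈ II) :
    |D k f t| ≤ (nrm ∞ (D k f)).toReal :=
  (ENNReal.ofReal_le_iff_le_toReal (hf.nrm_top_ne_top hk)).1
    (ofReal_abs_le_nrm_top (hf.continuousOn_D hk) ht)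

end LandauKolmogorov

/-! ### Comparison of the moduli and of the sets of constants -/

theorem mainTheorem9 (r k : ℕ) (hr : 1 ≤ r) (hk : k ≤ r - 1)
    (hφ : ∀ (lam : ℝ) (φ : ℝ → ℝ), LandauKolmogorov.IsEigenfunction r lam φ →
      LandauKolmogorov.nrm ∞ (LandauKolmogorov.D (r + k) φ) =
        ENNReal.ofReal |LandauKolmogorov.D (r + k) φ (-1)|) :
    (∀ δ : ℝ≥0,
      (LandauKolmogorov.Omega r k δ =
        (⨆ t ∈ Set.Icc (-1 : ℝ) 1, LandauKolmogorov.OmegaAt r k t δ)) ∧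
      ((⨆ t ∈ Set.Icc (-1 : ℝ) 1, LandauKolmogorov.OmegaAt r k t δ) =
        LandauKolmogorov.OmegaAt r k (-1) δ)) ∧
    LandauKolmogorov.Gam r k = LandauKolmogorov.GamAt r k (-1) := by
  open LandauKolmogorov in
  have hkr : k < r := by omega
  have hdom : ∀ f, MemL2 r f → ∃ g, MemL2 r g ∧ nrm 2 g = nrm 2 f ∧
      nrm 2 (D r g) = nrm 2 (D r f) ∧ nrm ∞ (D k f) ≤ ENNReal.ofReal |D k g (-1)| := by
    intro f hf
    obtain ⟨g, h1, h2, h3, h4⟩ := exists_dominating hkr hφ hf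
    exact ⟨g, h1, h2, h3, nrm_top_le h4⟩
  have hdom' : ∀ f, MemL2 r f → ∃ g, MemL2 r g ∧ nrm 2 g = nrm 2 f ∧
      nrm 2 (D r g) = nrm 2 (D r f) ∧ (nrm ∞ (D k f)).toReal ≤ |D k g (-1)| := by
    intro f hf
    obtain ⟨g, h1, h2, h3, h4⟩ := hdom f hf
    exact ⟨g, h1, h2, h3, ENNReal.toReal_le_of_le_ofReal (abs_nonneg _) h4⟩
  refine ⟨fun δ => ?_, ?_⟩
  · have h1 : Omega r k δ ≤ OmegaAt r k (-1) δ := by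
      refine iSup₂_le fun f hf => ?_
      obtain ⟨g, hg, hg2, hgr, hle⟩ := hdom f hf.1.1
      refine hle.trans (le_iSup₂_of_le (f := fun g _ => ENNReal.ofReal |D k g (-1)|) g ?_ le_rfl)
      exact ⟨⟨hg, hgr ▸ hf.1.2⟩, hg2 ▸ hf.2⟩
    have h2 : OmegaAt r k (-1) δ ≤ ⨆ t ∈ Set.Icc (-1 : ℝ) 1, OmegaAt r k t δ :=
      le_iSup₂_of_le (f := fun t _ => OmegaAt r k t δ) (-1) neg_one_mem_ii le_rfl
    have h3 : (⨆ t ∈ Set.Icc (-1 : ℝ) 1, OmegaAt r k t δ) ≤ Omega r k δ := by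
      refine iSup₂_le fun t ht => iSup₂_le fun f hf => ?_
      exact (ofReal_abs_le_nrm_top (hf.1.1.continuousOn_D hkr) ht).trans
        (le_iSup₂_of_le (f := fun f _ => nrm ∞ (D k f)) f hf le_rfl)
    exact ⟨le_antisymm (h1.trans h2) h3, le_antisymm (h3.trans h1) h2⟩
  -- The two families have the same upper bounds, hence the same suprema, although the values for an
  -- individual `f` may differ.
  · have hub : ∀ A C : ℝ,
        C ∈ upperBounds ((fun f => (nrm ∞ (D k f)).toReal - A * (nrm 2 f).toReal) '' W2 r) ↔
        C ∈ upperBounds ((fun f => |D k f (-1)| - A * (nrm 2 f).toReal) '' W2 r) := by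
      intro A C
      constructor
      · rintro hC _ ⟨f, hf, rfl⟩
        exact (sub_le_sub_right (hf.1.abs_D_le hkr neg_one_mem_ii) _).trans
          (hC (Set.mem_image_of_mem _ hf))
      · rintro hC _ ⟨f, hf, rfl⟩
        obtain ⟨g, hg, hg2, hgr, hle⟩ := hdom' f hf.1
        have h1 := hC (Set.mem_image_of_mem _ (⟨hg, hgr ▸ hf.2⟩ : g ∈ W2 r))
        beta_reduce at h1 ⊢
        rw [hg2] at h1
        linarith
    ext ⟨A, B⟩
    refine and_congr_right fun _ => and_congr_right fun _ => and_congr ⟨fun h f hf => ?_,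
      fun h f hf => ?_⟩ ?_
    · exact (hf.abs_D_le hkr neg_one_mem_ii).trans (h f hf)
    · obtain ⟨g, hg, hg2, hgr, hle⟩ := hdom' f hf
      have h1 := h g hg
      rw [hg2, hgr] at h1
      exact hle.trans h1
    · simp only [IsLUB, Set.ext (hub A)]
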